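/- Let $G$ be a locally compact Hausdorff topological group and let $T$ be a tree, i.e. a (Hausdorff) contractible $CW$-complex of dimension $\le 1$. Suppose that $G$ acts continuously on $T$ by cellular maps (the action preserves the $0$-skeleton $T_0$), such that for every $g\in G$ and every open cell $e$ with $g\cdot e\cap e\neq\emptyset$ we have $gx=x$ for all $x\in e$. Assume that the isotropy group $G_x$ of each $x\in T$ is compact. Then: (1) There is a compact normal subgroup $K\subseteq G$ which contains the identity component $G^0$ and acts trivially on $T$, such that $\overline G=G/K$ is totally disconnected; so $G$ is an extension $1\to K\to G\to\overline G\to 1$. (2) The skeletal filtration $T_0\subseteq T_1=T$ is a $G$-$CW$-structure on $T$, and with it $T$ is a model both for $E_{\mathcal{COM}}(G)$ and for $E_{\mathcal{COMOP}}(G)$. (3) The $G$-space $T$ is a model both for $J_{\mathcal{COM}}(G)$ and for $J_{\mathcal{COMOP}}(G)$. So $T$ is a $1$-dimensional model for $E_{\mathcal{COM}}(G)=J_{\mathcal{COM}}(G)=E_{\mathcal{COMOP}}(G)=J_{\mathcal{COMOP}}(G)$. Here $\mathcal{COM}$ and $\mathcal{COMOP}$ are the families of compact, respectively compact open, subgroups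 of $G$, and all spaces are Hausdorff. For a family $\mathcal F$ of closed subgroups (closed under conjugation and finite intersections), a model for $E_{\mathcal F}(G)$ is a $G$-$CW$-complex $X$ whose isotropy groups belong to $\mathcal F$ such that for every $G$-$CW$-complex $Y$ with isotropy groups in $\mathcal F$ there is, up to $G$-homotopy, precisely one $G$-map $Y\to X$. A $G$-space $X$ is $\mathcal F$-numerable if it has an open covering $\{U_i\}$ by $G$-subspaces, each of which admits a $G$-map to $G/G_i$ for some $G_i\in\mathcal F$, and a locally finite partition of unity subordinate to $\{U_i\}$ by $G$-invariant functions. A model for $J_{\mathcal F}(G)$ is an $\mathcal F$-numerable $G$-space $X$ such that for every $\mathcal F$-numerable $G$-space $Y$ there is, up to $G$-homotopy, precisely one $G$-map $Y\to X$. -/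

import Mathlib

universe u v w

/-! ### Families of subgroups -/

/-- A family of subgroups of a topological group `G`: a set of closed subgroups which is closed
under conjugation and (nonempty) finite intersections. -/
structure SubgroupFamily (G : Type*) [Group G] [TopologicalSpace G] where
  carrier : Set (Subgroup G)
  isClosed_of_mem : ∀ H ∈ carrier, IsClosed (H : Set G)
  conj_mem : ∀ H ∈ carrier, ∀ g : G, H.map (MulAut.conj g).toMonoidHom ∈ carrier
  inf_mem : ∀ H ∈ carrier, ∀ L ∈ carrier, H ⊓ L ∈ carrier

/-- The family of compact subgroups. -/
def compactSubgroups (G : Type*) [Group G] [TopologicalSpace G] [IsTopologicalGroup G]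
    [T2Space G] : SubgroupFamily G where
  carrier := {H | IsCompact (H : Set G)}
  isClosed_of_mem := fun _ hH => IsCompact.isClosed hH
  conj_mem := by
    intro H hH g
    have hc : Continuous (fun x : G => g * x * g⁻¹) := by fun_prop
    have h := IsCompact.image hH hc
    exact h
  inf_mem := by
    intro H hH L hL
    simpa using IsCompact.inter hH hL

/-- The family of compact open subgroups. -/
def compactOpenSubgroups (G : Type*) [Group G] [TopologicalSpace G] [IsTopologicalGroup G]
    [T2Space G] : SubgroupFamily G where
  carrier := {H | IsCompact (H : Set G) ∧ IsOpen (H : Set G)}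
  isClosed_of_mem := fun _ hH => IsCompact.isClosed hH.1
  conj_mem := by
    intro H hH g
    refine ⟨(compactSubgroups G).conj_mem H hH.1 g, ?_⟩
    have h := ((Homeomorph.mulLeft g).trans (Homeomorph.mulRight g⁻¹)).isOpenMap _ hH.2
    have e : ((H.map (MulAut.conj g).toMonoidHom : Subgroup G) : Set G) =
        (fun x : G => g * x * g⁻¹) '' (H : Set G) := rfl
    rw [e]
    exact h
  inf_mem := by
    intro H hH L hL
    exact ⟨(compactSubgroups G).inf_mem H hH.1 L hL.1, by simpa using hH.2.inter hL.2⟩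

/-! ### Equivariant maps and homotopies -/

/-- A continuous map is a `G`-map if it is `G`-equivariant. -/
def IsGMap (G : Type*) {X Y : Type*} [Group G] [TopologicalSpace X] [MulAction G X]
    [TopologicalSpace Y] [MulAction G Y] (f : C(X, Y)) : Prop :=
  ∀ (g : G) (x : X), f (g • x) = g • f x

/-- Two maps are `G`-homotopic if they are homotopic through `G`-maps. -/
def GHomotopic (G : Type*) {X Y : Type*} [Group G] [TopologicalSpace X] [MulAction G X]
    [TopologicalSpace Y] [MulAction G Y] (f₀ f₁ : C(X, Y)) : Prop :=
  ContinuousMap.HomotopicWith f₀ f₁ (IsGMap G)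

/-- Up to `G`-homotopy there is precisely one `G`-map from `Y` to `X`. -/
def UniqueGMapUpToHomotopy (G : Type*) (Y X : Type*) [Group G] [TopologicalSpace Y]
    [MulAction G Y] [TopologicalSpace X] [MulAction G X] : Prop :=
  (∃ f : C(Y, X), IsGMap G f) ∧
    ∀ f₀ f₁ : C(Y, X), IsGMap G f₀ → IsGMap G f₁ → GHomotopic G f₀ f₁

/-! ### `G`-CW-complexes -/

/-- The closed unit disk `D^n`. -/
abbrev Disk (n : ℕ) : Type := Metric.closedBall (0 : EuclideanSpace ℝ (Fin n)) 1

/-- The subspace `B` of the `G`-space `X` is obtained from `A ⊆ B` by attaching equivariant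
`n`-cells: there is a `G`-pushout with corners `∐ᵢ G/Hᵢ × S^{n-1}`, `A`, `∐ᵢ G/Hᵢ × D^n`, `B`, in
which `A → B` is the inclusion. As `S^{n-1} → D^n` is injective, the pushout condition says: `Q`
maps `∐ᵢ G/Hᵢ × S^{n-1}` to `A`, maps `∐ᵢ G/Hᵢ × (D^n - S^{n-1})` bijectively onto `B - A`, and `B`
carries the final topology with respect to `A → B` and `Q`. -/
def AttachesEquivariantCells (G : Type u) {X : Type v} [Group G] [TopologicalSpace G]
    [TopologicalSpace X] [MulAction G X] (n : ℕ) (A B : Set X) : Prop :=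
  ∃ (ι : Type v) (H : ι → Subgroup G) (Q : ∀ i, (G ⧸ H i) × Disk n → X),
    (∀ i, IsClosed (H i : Set G)) ∧
    (∀ i, Continuous (Q i)) ∧
    (∀ i (g : G) (c : G ⧸ H i) (d : Disk n), Q i (g • c, d) = g • Q i (c, d)) ∧
    (∀ i (c : G ⧸ H i) (d : Disk n), ‖d.1‖ = 1 → Q i (c, d) ∈ A) ∧
    Set.BijOn (fun p : Σ i, (G ⧸ H i) × Disk n => Q p.1 p.2) {p | ‖p.2.2.1‖ < 1} (B \ A) ∧
    (∀ C : Set X, IsClosed ((↑) ⁻¹' C : Set B) ↔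
      IsClosed ((↑) ⁻¹' C : Set A) ∧ ∀ i, IsClosed (Q i ⁻¹' C))

/-- A `G`-CW-structure on a `G`-space `X`: a `G`-invariant filtration
`∅ = X_{-1} ⊆ X_0 ⊆ X_1 ⊆ ...` with union `X`, such that `X` carries the colimit topology and
`X_n` is obtained from `X_{n-1}` by attaching equivariant `n`-cells. -/
structure GCWStructure (G : Type*) (X : Type*) [Group G] [TopologicalSpace G]
    [TopologicalSpace X] [MulAction G X] where
  skel : ℕ → Set X
  mono : Monotone skel
  smul_mem : ∀ (n : ℕ) (g : G), ∀ x ∈ skel n, g • x ∈ skel n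
  iUnion_skel : ⋃ n, skel n = Set.univ
  isClosed_iff : ∀ C : Set X, IsClosed C ↔ ∀ n, IsClosed ((↑) ⁻¹' C : Set (skel n))
  attach_zero : AttachesEquivariantCells G 0 ∅ (skel 0)
  attach_succ : ∀ n, AttachesEquivariantCells G (n + 1) (skel n) (skel (n + 1))

/-- A `G`-space `X` with a `G`-CW-structure `S` is a model for the classifying `G`-CW-complex
`E_F(G)`: its isotropy groups belong to `F`, and every `G`-CW-complex with isotropy groups in `F`
admits up to `G`-homotopy precisely one `G`-map to `X`. (Spaces are Hausdorff.) -/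
def GCWStructure.IsModelE {G : Type u} {X : Type v} [Group G] [TopologicalSpace G]
    [TopologicalSpace X] [MulAction G X] (_S : GCWStructure G X) (F : SubgroupFamily G) : Prop :=
  (∀ x : X, MulAction.stabilizer G x ∈ F.carrier) ∧
  ∀ (Y : Type w) [TopologicalSpace Y] [T2Space Y] [MulAction G Y] [ContinuousSMul G Y],
    Nonempty (GCWStructure G Y) → (∀ y : Y, MulAction.stabilizer G y ∈ F.carrier) →
      UniqueGMapUpToHomotopy G Y X

/-! ### Numerable `G`-spaces -/

/-- A `G`-space `X` is `F`-numerable if it has an open covering by `G`-subspaces `U i`, each of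
which admits a `G`-map to some `G/H` with `H ∈ F`, together with a subordinate locally finite
partition of unity by `G`-invariant functions. -/
def IsNumerable {G : Type u} [Group G] [TopologicalSpace G] (F : SubgroupFamily G)
    (X : Type v) [TopologicalSpace X] [MulAction G X] : Prop :=
  ∃ (ι : Type v) (U : ι → Set X) (e : PartitionOfUnity ι X),
    (∀ i, IsOpen (U i)) ∧
    (∀ i (g : G), ∀ x ∈ U i, g • x ∈ U i) ∧
    (⋃ i, U i = Set.univ) ∧
    (∀ i, ∃ H ∈ F.carrier, ∃ φ : U i → G ⧸ H, Continuous φ ∧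
      ∀ (g : G) (x y : U i), (y : X) = g • (x : X) → φ y = g • φ x) ∧
    e.IsSubordinate U ∧
    (∀ i (g : G) (x : X), e i (g • x) = e i x)

/-- A `G`-space `X` is a model for the classifying numerable `G`-space `J_F(G)`: it is
`F`-numerable, and every `F`-numerable `G`-space admits up to `G`-homotopy precisely one `G`-map
to `X`. (Spaces are Hausdorff.) -/
def IsModelJ {G : Type u} [Group G] [TopologicalSpace G] (F : SubgroupFamily G)
    (X : Type v) [TopologicalSpace X] [MulAction G X] : Prop :=
  IsNumerable F X ∧
  ∀ (Y : Type w) [TopologicalSpace Y] [T2Space Y] [MulAction G Y] [ContinuousSMul G Y],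
    IsNumerable F Y → UniqueGMapUpToHomotopy G Y X

/-! ### Trees -/

/-- A tree: a contractible CW-complex of dimension at most one. -/
structure IsCWTree (T : Type*) [TopologicalSpace T]
    [Topology.CWComplex (Set.univ : Set T)] : Prop where
  contractible : ContractibleSpace T
  isEmpty_cell : ∀ n, 2 ≤ n → IsEmpty (Topology.RelCWComplex.cell (Set.univ : Set T) n)

/-! A contractible one-dimensional complex has unique geodesics that vary continuously with their
end points. Every part of the theorem about maps into `T` follows from this.

Geometry. Wrapping one edge around the circle and collapsing everything else gives a map `T → ℝ/ℤ`.
It lifts to `ℝ` because `T` is contractible (`exists_lift`), and the lift yields a coordinate that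
parametrizes this edge and is constant on every other one (`exists_coord`). The coordinates define
the path metric, in which betweenness is tested coordinate by coordinate. Triangles are tripods
(`Between.or`), so geodesics are unique. They are jointly continuous for the CW topology
(`continuous_geodesic`), which can be finer than the metric topology at vertices of infinite
valence.

Equivariance. The hypothesis on open cells excludes inversions, so the edges can be parametrized
equivariantly (`exists_equivariant`), and then `G` preserves coordinates, metric and geodesics. Two
`G`-maps into `T` are therefore always joined by the geodesic homotopy (`gHomotopic`), which is the
uniqueness half for both `E` and `J`. For existence, a compact subgroup `H` fixes the circumcenter
of an orbit (`exists_fixed_point`), so there is a `G`-map `G/H → T`. Numerable sources are handled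
by mixing such maps along geodesics with a partition of unity (`exists_isGMap_of_isNumerable`),
`G`-CW-complexes by coning off each cell to a fixed point (`exists_isGMap_of_gcwStructure`).

The space `T` itself. Vertices form a closed discrete set and open edges are open, so all
stabilizers are open, hence compact open (`isOpen_stabilizer`). This gives the `G`-CW-structure, it
puts the isotropy groups in both families, and it makes the kernel of the action the required
subgroup `K`. Disjoint neighbourhoods of the vertices and of the midpoints of edges show that `T` is
numerable (`isNumerable`). -/

section

open Set Filter Topology Function

/-! ### Trees with coordinates -/

/-- The nearest point of `[0, 1]`. -/
def clamp (s : ℝ) : ℝ := max 0 (min 1 s)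

lemma continuous_clamp : Continuous clamp := by unfold clamp; fun_prop

lemma clamp_mem (s : ℝ) : clamp s ∈ Icc (0 : ℝ) 1 := by
  unfold clamp; constructor <;> simp

lemma clamp_of_mem {s : ℝ} (h : s ∈ Icc (0 : ℝ) 1) : clamp s = s := by
  unfold clamp; rw [min_eq_right h.2, max_eq_right h.1]

/-- Characteristic maps of the edges of a one-dimensional CW-complex `T`, extended constantly to
the real line, such that every edge `e` separates `T`: the coordinate function `coord e` is inverse
to the characteristic map on `e` and constant on all other edges. -/
structure TreeCoordinates (T : Type*) [TopologicalSpace T] (E : Type*) where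
  edge : E → ℝ → T
  coord : E → T → ℝ
  edge_clamp : ∀ e s, edge e (clamp s) = edge e s
  coord_edge_self : ∀ e s, coord e (edge e s) = clamp s
  coord_edge_of_ne : ∀ e f, e ≠ f → ∀ s s', coord e (edge f s) = coord e (edge f s')
  coord_mem : ∀ e x, coord e x ∈ Icc (0 : ℝ) 1
  edge_coord : ∀ e x, coord e x ∈ Ioo (0 : ℝ) 1 → edge e (coord e x) = x
  isClosed_iff : ∀ A : Set T, IsClosed A ↔ ∀ e, IsClosed (edge e ⁻¹' A)

namespace TreeCoordinates

variable {T E : Type*} [TopologicalSpace T] (C : TreeCoordinates T E)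

lemma isOpen_iff (A : Set T) : IsOpen A ↔ ∀ e, IsOpen (C.edge e ⁻¹' A) := by
  rw [← isClosed_compl_iff, C.isClosed_iff]
  simp only [preimage_compl, isClosed_compl_iff]

lemma continuous_iff {Z : Type*} [TopologicalSpace Z] (f : T → Z) :
    Continuous f ↔ ∀ e, Continuous fun s => f (C.edge e s) := by
  simp only [continuous_def, C.isOpen_iff]
  exact ⟨fun h e A hA => h A hA e, fun h A hA e => h e A hA⟩

lemma continuous_edge (e : E) : Continuous (C.edge e) :=
  (C.continuous_iff (id : T → T)).1 continuous_id e

lemma edge_coord_of_mem_range {e : E} {x : T} (h : x ∈ range (C.edge e)) :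
    C.edge e (C.coord e x) = x := by
  obtain ⟨s, rfl⟩ := h
  rw [C.coord_edge_self, C.edge_clamp]

section connected

variable [PreconnectedSpace T]

/-- A set that contains every edge it meets is clopen in the weak topology. This is the induction
principle that replaces walking along edge paths. -/
lemma mem_of_edges {A : Set T} (hA : A.Nonempty)
    (h : ∀ e s s', C.edge e s ∈ A → C.edge e s' ∈ A) (x : T) : x ∈ A := by
  have key : ∀ e, C.edge e ⁻¹' A = ∅ ∨ C.edge e ⁻¹' A = univ := by
    intro e
    rcases (C.edge e ⁻¹' A).eq_empty_or_nonempty with h0 | ⟨s, hs⟩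
    · exact Or.inl h0
    · exact Or.inr (eq_univ_of_forall fun s' => h e s s' hs)
  have hcl : IsClosed A := (C.isClosed_iff A).2 fun e => by
    rcases key e with h | h <;> rw [h] <;> simp
  have hop : IsOpen A := (C.isOpen_iff A).2 fun e => by
    rcases key e with h | h <;> rw [h] <;> simp
  rw [IsClopen.eq_univ ⟨hcl, hop⟩ hA]
  trivial

/-- Moving along an edge changes only the coordinate of that edge. -/
lemma finite_coord_ne (x y : T) : {e | C.coord e x ≠ C.coord e y}.Finite := by
  refine C.mem_of_edges (A := {y | {e | C.coord e x ≠ C.coord e y}.Finite})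
    ⟨x, by simp⟩ (fun f s s' hs => ?_) y
  refine (Finite.insert f hs).subset fun e he => ?_
  by_cases h : e = f
  · exact Or.inl h
  · right
    simp only [mem_ofPred_eq] at he ⊢
    rwa [C.coord_edge_of_ne e f h s s']

/-- Of two edges, each lies on one side of the other. -/
lemma coord_eq_or_coord_eq {e f : E} (h : e ≠ f) (p : T) :
    C.coord e p = C.coord e (C.edge f 0) ∨ C.coord f p = C.coord f (C.edge e 0) := by
  refine C.mem_of_edges (A := {p | C.coord e p = C.coord e (C.edge f 0) ∨
    C.coord f p = C.coord f (C.edge e 0)}) ⟨C.edge f 0, Or.inl rfl⟩ (fun g s s' hs => ?_) p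
  simp only [mem_ofPred_eq] at hs ⊢
  by_cases h1 : e = g
  · subst h1
    exact Or.inr (C.coord_edge_of_ne _ _ (Ne.symm h) _ _)
  by_cases h2 : f = g
  · subst h2
    exact Or.inl (C.coord_edge_of_ne _ _ h _ _)
  rwa [C.coord_edge_of_ne e g h1 s' s, C.coord_edge_of_ne f g h2 s' s]

/-- The separating edge is the first one on the way from `x` to `y`. That it contains `x` is what
lets small coordinate boxes form a neighbourhood basis. -/
lemma exists_coord_ne {x y : T} (h : x ≠ y) :
    ∃ e, x ∈ range (C.edge e) ∧ C.coord e y ≠ C.coord e x := by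
  have := C.mem_of_edges (A := {y | y = x ∨ ∃ e, x ∈ range (C.edge e) ∧
    C.coord e y ≠ C.coord e x}) ⟨x, Or.inl rfl⟩ (fun f s s' hs => ?_) y
  · exact this.resolve_left h.symm
  simp only [mem_ofPred_eq] at hs ⊢
  by_cases hf : x ∈ range (C.edge f)
  · by_cases hc : C.coord f (C.edge f s') = C.coord f x
    · left
      rw [← C.edge_coord_of_mem_range hf, ← hc, C.coord_edge_self, C.edge_clamp]
    · exact Or.inr ⟨f, hf, hc⟩
  · rcases hs with hs | ⟨e, he, hne⟩
    · exact absurd ⟨s, hs⟩ hf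
    · refine Or.inr ⟨e, he, ?_⟩
      have hef : e ≠ f := by rintro rfl; exact hf he
      rwa [C.coord_edge_of_ne e f hef s' s]

end connected

/-! #### The metric -/

/-- The path metric, in which edges have length one. -/
noncomputable def pathDist (x y : T) : ℝ := ∑ᶠ e, |C.coord e x - C.coord e y|

lemma pathDist_eq_sum {x y : T} {S : Finset E} (h : ∀ e ∉ S, C.coord e x = C.coord e y) :
    C.pathDist x y = ∑ e ∈ S, |C.coord e x - C.coord e y| := by
  refine finsum_eq_sum_of_support_subset _ fun e he => ?_
  by_contra hS
  exact he (by simp [h e hS])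

lemma pathDist_self (x : T) : C.pathDist x x = 0 := by simp [pathDist]

lemma pathDist_comm (x y : T) : C.pathDist x y = C.pathDist y x := by
  simp only [pathDist, abs_sub_comm]

lemma pathDist_nonneg (x y : T) : 0 ≤ C.pathDist x y := finsum_nonneg fun _ => abs_nonneg _

/-- `z` lies on the geodesic from `x` to `y`. -/
def Between (x z y : T) : Prop :=
  ∀ e, |C.coord e x - C.coord e z| + |C.coord e z - C.coord e y| = |C.coord e x - C.coord e y|

section connected

variable [PreconnectedSpace T]

lemma exists_finset_coord_eq (x y z : T) :
    ∃ S : Finset E, ∀ e ∉ S, C.coord e x = C.coord e y ∧ C.coord e y = C.coord e z := by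
  classical
  refine ⟨(C.finite_coord_ne x y).toFinset ∪ (C.finite_coord_ne y z).toFinset, fun e he => ?_⟩
  simpa using he

lemma pathDist_triangle (x y z : T) : C.pathDist x z ≤ C.pathDist x y + C.pathDist y z := by
  obtain ⟨S, hS⟩ := C.exists_finset_coord_eq x y z
  rw [C.pathDist_eq_sum fun e he => (hS e he).1.trans (hS e he).2, C.pathDist_eq_sum fun e he => (hS e he).1,
    C.pathDist_eq_sum fun e he => (hS e he).2, ← Finset.sum_add_distrib]
  exact Finset.sum_le_sum fun e _ => abs_sub_le _ _ _

lemma abs_coord_sub_le (e : E) (x y : T) : |C.coord e x - C.coord e y| ≤ C.pathDist x y := by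
  classical
  obtain ⟨S, hS⟩ := C.exists_finset_coord_eq x y y
  rw [C.pathDist_eq_sum fun e he => (hS e he).1]
  by_cases he : e ∈ S
  · exact Finset.single_le_sum (f := fun e => |C.coord e x - C.coord e y|)
      (fun _ _ => abs_nonneg _) he
  · have : C.coord e x = C.coord e y := (hS e he).1
    rw [this, sub_self, abs_zero]
    exact Finset.sum_nonneg fun _ _ => abs_nonneg _

lemma eq_of_pathDist_le_zero {x y : T} (h : C.pathDist x y ≤ 0) : x = y := by
  by_contra hne
  obtain ⟨e, -, he⟩ := C.exists_coord_ne hne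
  have := (C.abs_coord_sub_le e x y).trans h
  exact he (sub_eq_zero.1 (abs_nonpos_iff.1 this)).symm

/-- A finite sum of triangle inequalities is an equality exactly when each summand is. -/
lemma between_iff {x z y : T} :
    C.Between x z y ↔ C.pathDist x z + C.pathDist z y = C.pathDist x y := by
  obtain ⟨S, hS⟩ := C.exists_finset_coord_eq x z y
  rw [C.pathDist_eq_sum fun e he => (hS e he).1.trans (hS e he).2, C.pathDist_eq_sum fun e he => (hS e he).1,
    C.pathDist_eq_sum fun e he => (hS e he).2, ← Finset.sum_add_distrib, eq_comm,
    Finset.sum_eq_sum_iff_of_le fun e _ => abs_sub_le _ _ _]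
  refine ⟨fun h e _ => (h e).symm, fun h e => ?_⟩
  by_cases he : e ∈ S
  · exact (h e he).symm
  · have h1 : C.coord e x = C.coord e z := (hS e he).1
    have h2 : C.coord e z = C.coord e y := (hS e he).2
    rw [h1, h2]; simp

lemma abs_add_abs_eq_iff {a b c : ℝ} :
    |a - b| + |b - c| = |a - c| ↔ (a ≤ b ∧ b ≤ c) ∨ (c ≤ b ∧ b ≤ a) := by
  constructor
  · intro h
    by_contra! hc
    rcases abs_cases (a - b) with h1 | h1 <;> rcases abs_cases (b - c) with h2 | h2 <;>
      rcases abs_cases (a - c) with h3 | h3 <;> grind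
  · rintro (⟨h1, h2⟩ | ⟨h1, h2⟩)
    · rw [abs_of_nonpos (by linarith), abs_of_nonpos (by linarith), abs_of_nonpos (by linarith)]
      ring
    · rw [abs_of_nonneg (by linarith), abs_of_nonneg (by linarith), abs_of_nonneg (by linarith)]
      ring

variable {C} in
/-- Geodesic triangles are tripods. -/
lemma Between.or {x z y : T} (h : C.Between x z y) (p : T) : C.Between p z x ∨ C.Between p z y := by
  by_contra! hc
  obtain ⟨h1, h2⟩ := hc
  simp only [Between, not_forall, abs_add_abs_eq_iff] at h1 h2
  obtain ⟨e, he⟩ := h1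
  obtain ⟨f, hf⟩ := h2
  have h1 := abs_add_abs_eq_iff.1 (h e)
  have h2 := abs_add_abs_eq_iff.1 (h f)
  -- In coordinate `e` the points `p`, `x` lie strictly on one side of `z`, and in coordinate `f` so
  -- do `p`, `y`. If `e = f`, this contradicts betweenness on the line. Otherwise each of the four
  -- points has the standard value in one of the two coordinates, and no distribution of these
  -- values is consistent.
  by_cases hef : e = f
  · subst hef; grind
  · have a := C.coord_eq_or_coord_eq hef p
    have b := C.coord_eq_or_coord_eq hef x
    have c := C.coord_eq_or_coord_eq hef y
    have d := C.coord_eq_or_coord_eq hef z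
    grind

variable {C} in
-- By the tripod property, `z` lies between `z'` and one of the end points. Both points are equally
-- far from that end point, so their distance is zero.
lemma Between.eq_of_pathDist_eq {x z z' y : T} (h : C.Between x z y) (h' : C.Between x z' y)
    (hd : C.pathDist x z = C.pathDist x z') : z = z' := by
  have h1 := C.between_iff.1 h
  have h2 := C.between_iff.1 h'
  symm
  apply C.eq_of_pathDist_le_zero
  rcases h.or z' with h3 | h3
  · have h3 := C.between_iff.1 h3
    rw [C.pathDist_comm z x, C.pathDist_comm z' x] at h3
    linarith
  · have h3 := C.between_iff.1 h3
    linarith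

/-- Along the edge `f` only the summand of `f` varies. -/
lemma pathDist_edge (x : T) (f : E) (s s' : ℝ) :
    C.pathDist x (C.edge f s) - |C.coord f x - clamp s| =
      C.pathDist x (C.edge f s') - |C.coord f x - clamp s'| := by
  classical
  obtain ⟨S, hS⟩ := C.exists_finset_coord_eq x (C.edge f s) (C.edge f s')
  have hS' := fun e (he : e ∉ insert f S) => hS e fun h => he (Finset.mem_insert_of_mem h)
  rw [C.pathDist_eq_sum fun e he => (hS' e he).1, C.pathDist_eq_sum fun e he => (hS' e he).1.trans (hS' e he).2,
    ← Finset.add_sum_erase _ _ (Finset.mem_insert_self f S),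
    ← Finset.add_sum_erase _ _ (Finset.mem_insert_self f S), C.coord_edge_self, C.coord_edge_self,
    add_sub_cancel_left, add_sub_cancel_left]
  refine Finset.sum_congr rfl fun e he => ?_
  rw [C.coord_edge_of_ne e f (Finset.ne_of_mem_erase he) s s']

lemma continuous_pathDist_right (x : T) : Continuous (C.pathDist x) := by
  refine (C.continuous_iff _).2 fun f => ?_
  have : (fun s => C.pathDist x (C.edge f s)) = fun s =>
      C.pathDist x (C.edge f 0) - |C.coord f x - clamp 0| + |C.coord f x - clamp s| := by
    funext s
    rw [← C.pathDist_edge x f s 0]; ring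
  rw [this]
  have := continuous_clamp
  fun_prop

/-- Existence of geodesics is a connectedness argument: were no point between `x` and `y` at
distance `s` from `x`, a sublevel set of the difference of the distances to `x` and `y` would be
clopen. -/
lemma exists_between (x y : T) {s : ℝ} (h0 : 0 ≤ s) (h1 : s ≤ C.pathDist x y) :
    ∃ z, C.Between x z y ∧ C.pathDist x z = s := by
  by_contra! hno
  set p : T → ℝ := fun q => C.pathDist x q - C.pathDist y q with hp
  have hpc : Continuous p := (C.continuous_pathDist_right x).sub (C.continuous_pathDist_right y)
  -- For `q` between `x` and `y`, `p q = r` says that `q` has distance `s` from `x`.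
  set r := 2 * s - C.pathDist x y with hr
  have hnb : ∀ q, p q = r → ¬ C.Between x q y := by
    intro q hq hb
    refine hno q hb ?_
    have := C.between_iff.1 hb
    rw [C.pathDist_comm q y] at this
    simp only [hp] at hq
    linarith
  have hop : IsOpen {q | p q ≤ r} := by
    refine (C.isOpen_iff _).2 fun f => isOpen_iff_mem_nhds.2 fun s0 hs0 => ?_
    rcases lt_or_eq_of_le (show p (C.edge f s0) ≤ r from hs0) with hlt | heq
    · filter_upwards [(hpc.comp (C.continuous_edge f)).continuousAt.eventually_lt_const hlt]
        with s hs using le_of_lt hs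
    · have hconst : ∀ s, p (C.edge f s) = r - (|C.coord f x - clamp s0| - |C.coord f y - clamp s0|)
          + (|C.coord f x - clamp s| - |C.coord f y - clamp s|) := by
        intro s
        have e1 := C.pathDist_edge x f s s0
        have e2 := C.pathDist_edge y f s s0
        simp only [hp] at heq ⊢
        linarith
      -- At a point off the geodesic, `p` is locally constant along edges. Either `x` and `y` lie
      -- strictly on the same side in coordinate `f`, or another edge shows the failure and then `x`
      -- and `y` have the same coordinate `f`.
      suffices ∀ᶠ s in 𝓝 s0, |C.coord f x - clamp s| - |C.coord f y - clamp s| =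
          |C.coord f x - clamp s0| - |C.coord f y - clamp s0| by
        filter_upwards [this] with s hs
        simp only [mem_preimage, mem_ofPred_eq, hconst s, hs]
        linarith
      have hne := hnb _ heq
      simp only [Between, not_forall, abs_add_abs_eq_iff] at hne
      obtain ⟨e, he⟩ := hne
      by_cases hef : e = f
      · subst hef
        rw [C.coord_edge_self] at he
        have hc : ContinuousAt clamp s0 := continuous_clamp.continuousAt
        have : (clamp s0 < C.coord e x ∧ clamp s0 < C.coord e y) ∨
            (C.coord e x < clamp s0 ∧ C.coord e y < clamp s0) := by grind
        rcases this with ⟨ha, hb⟩ | ⟨ha, hb⟩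
        · filter_upwards [hc.eventually_lt_const ha, hc.eventually_lt_const hb] with s h1 h2
          rw [abs_of_pos (by linarith), abs_of_pos (by linarith), abs_of_pos (by linarith),
            abs_of_pos (by linarith)]
          ring
        · filter_upwards [hc.eventually_const_lt ha, hc.eventually_const_lt hb] with s h1 h2
          rw [abs_of_neg (by linarith), abs_of_neg (by linarith), abs_of_neg (by linarith),
            abs_of_neg (by linarith)]
          ring
      · rw [C.coord_edge_of_ne e f hef s0 0] at he
        have hx := C.coord_eq_or_coord_eq hef x
        have hy := C.coord_eq_or_coord_eq hef y
        have : C.coord f x = C.coord f y := by grind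
        simp [this]
  have hcl : IsClosed {q | p q ≤ r} := isClosed_le hpc continuous_const
  have hx : x ∈ {q | p q ≤ r} := by
    simp only [hp, mem_ofPred_eq, pathDist_self, hr]
    rw [C.pathDist_comm y x]; linarith
  have hy : y ∈ {q | p q ≤ r} := by
    rw [IsClopen.eq_univ ⟨hcl, hop⟩ ⟨x, hx⟩]; trivial
  -- Since `y` is in the sublevel set, `s` is the full distance, and then `y` itself is the excluded
  -- point.
  simp only [hp, mem_ofPred_eq, pathDist_self, hr] at hy
  refine hno y (C.between_iff.2 (by simp [pathDist_self])) (by linarith)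

/-! #### The topology -/

/-- The points whose coordinates are close to those of `z`. -/
def box (z : T) (ε : E → ℝ) : Set T := {q | ∀ e, |C.coord e q - C.coord e z| < ε e}

omit [PreconnectedSpace T] in
lemma mem_box_self {z : T} {ε : E → ℝ} (hε : ∀ e, 0 < ε e) : z ∈ C.box z ε := fun e => by
  simpa using hε e

omit [PreconnectedSpace T] in
-- Infinitely many constraints are harmless: on a given edge all but one of them are constant, so
-- its trace is empty or cut out by a single inequality.
lemma isOpen_box (z : T) (ε : E → ℝ) : IsOpen (C.box z ε) := by
  refine (C.isOpen_iff _).2 fun f => ?_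
  by_cases h : ∀ e ≠ f, |C.coord e (C.edge f 0) - C.coord e z| < ε e
  · have : C.edge f ⁻¹' C.box z ε = {s | |clamp s - C.coord f z| < ε f} := by
      ext s
      simp only [box, mem_preimage, mem_ofPred_eq]
      refine ⟨fun hs => by simpa [C.coord_edge_self] using hs f, fun hs e => ?_⟩
      by_cases hef : e = f
      · subst hef; rwa [C.coord_edge_self]
      · rw [C.coord_edge_of_ne e f hef s 0]; exact h e hef
    rw [this]
    have := continuous_clamp
    exact isOpen_lt (by fun_prop) continuous_const
  · have : C.edge f ⁻¹' C.box z ε = ∅ := by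
      refine eq_empty_of_forall_notMem fun s hs => h fun e he => ?_
      rw [C.coord_edge_of_ne e f he 0 s]
      exact hs e
    rw [this]; exact isOpen_empty

/-- Boxes with a separate radius for each edge are a neighbourhood basis of the weak topology. Only
the radii of edges through `z` matter. -/
lemma exists_box_subset {z : T} {U : Set T} (hU : IsOpen U) (hz : z ∈ U) :
    ∃ ε : E → ℝ, (∀ e, 0 < ε e) ∧ C.box z ε ⊆ U := by
  have key : ∀ f, ∃ ε > 0, z ∈ range (C.edge f) → ∀ q, |C.coord f q - C.coord f z| < ε →
      C.coord f q ≠ C.coord f z → q ∈ U := by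
    intro f
    by_cases hzf : z ∈ range (C.edge f)
    · have hz' : C.edge f (C.coord f z) ∈ U := by rwa [C.edge_coord_of_mem_range hzf]
      obtain ⟨η, hη, hball⟩ := Metric.isOpen_iff.1 (hU.preimage (C.continuous_edge f))
        (C.coord f z) hz'
      have hm := C.coord_mem f z
      -- The radius `θ` keeps the coordinate away from the end points other than `z`, so that
      -- `edge_coord` places `q` on the edge `f` itself.
      obtain ⟨θ, hθ, hθ'⟩ : ∃ θ > 0, ∀ t ∈ Icc (0 : ℝ) 1, |t - C.coord f z| < θ →
          t ≠ C.coord f z → t ∈ Ioo (0 : ℝ) 1 := by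
        have aux : ∀ t ∈ Icc (0 : ℝ) 1, t ≠ 0 → t ≠ 1 → t ∈ Ioo (0 : ℝ) 1 := fun t ht h0 h1 =>
          ⟨lt_of_le_of_ne ht.1 h0.symm, lt_of_le_of_ne ht.2 h1⟩
        by_cases h0 : C.coord f z = 0
        · refine ⟨1, one_pos, fun t ht h1 h2 => aux t ht (h0 ▸ h2) ?_⟩
          rintro rfl; simp [h0] at h1
        by_cases h1 : C.coord f z = 1
        · refine ⟨1, one_pos, fun t ht h2 h3 => aux t ht ?_ (h1 ▸ h3)⟩
          rintro rfl; simp [h1] at h2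
        have := aux _ hm h0 h1
        refine ⟨min (C.coord f z) (1 - C.coord f z), lt_min this.1 (by linarith [this.2]),
          fun t ht h2 h3 => ?_⟩
        have h4 := abs_lt.1 (h2.trans_le (min_le_left _ _))
        have h5 := abs_lt.1 (h2.trans_le (min_le_right _ _))
        exact ⟨by linarith, by linarith⟩
      refine ⟨min η θ, lt_min hη hθ, fun _ q hq hne => ?_⟩
      have h1 := hθ' _ (C.coord_mem f q) (hq.trans_le (min_le_right _ _)) hne
      rw [← C.edge_coord f q h1]
      exact hball (by simpa [Real.dist_eq] using hq.trans_le (min_le_left _ _))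
    · exact ⟨1, one_pos, fun h => absurd h hzf⟩
  choose ε hε h using key
  refine ⟨ε, hε, fun q hq => ?_⟩
  by_cases hqz : z = q
  · exact hqz ▸ hz
  · obtain ⟨e, he, hne⟩ := C.exists_coord_ne hqz
    exact h e he q (hq e) hne

omit [PreconnectedSpace T] in
variable {C} in
-- Boxes are geodesically convex, one coordinate at a time.
lemma Between.mem_box {x z y p : T} {ε : E → ℝ} (h : C.Between x z y) {e : E}
    (hx : |C.coord e x - C.coord e p| < ε e) (hy : |C.coord e y - C.coord e p| < ε e) :
    |C.coord e z - C.coord e p| < ε e := by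
  have := abs_add_abs_eq_iff.1 (h e)
  rw [abs_lt] at *
  grind

/-! #### Geodesics -/

lemma exists_geodesic (x y : T) (t : ℝ) :
    ∃ z, C.Between x z y ∧ C.pathDist x z = clamp t * C.pathDist x y :=
  C.exists_between x y (mul_nonneg (clamp_mem t).1 (C.pathDist_nonneg _ _))
    (mul_le_of_le_one_left (C.pathDist_nonneg _ _) (clamp_mem t).2)

/-- The point at time `t` on the geodesic from `x` to `y`. -/
noncomputable def geodesic (x y : T) (t : ℝ) : T := (C.exists_geodesic x y t).choose

lemma between_geodesic (x y : T) (t : ℝ) : C.Between x (C.geodesic x y t) y :=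
  (C.exists_geodesic x y t).choose_spec.1

lemma pathDist_geodesic (x y : T) (t : ℝ) :
    C.pathDist x (C.geodesic x y t) = clamp t * C.pathDist x y :=
  (C.exists_geodesic x y t).choose_spec.2

lemma pathDist_geodesic_right (x y : T) (t : ℝ) :
    C.pathDist (C.geodesic x y t) y = (1 - clamp t) * C.pathDist x y := by
  have h1 := C.between_iff.1 (C.between_geodesic x y t)
  rw [C.pathDist_geodesic] at h1
  linarith

lemma eq_geodesic {x y z : T} {t : ℝ} (h1 : C.pathDist x z = clamp t * C.pathDist x y)
    (h2 : C.pathDist z y = (1 - clamp t) * C.pathDist x y) : z = C.geodesic x y t :=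
  Between.eq_of_pathDist_eq (C.between_iff.2 (by rw [h1, h2]; ring)) (C.between_geodesic x y t)
    (by rw [h1, C.pathDist_geodesic])

lemma geodesic_zero (x y : T) : C.geodesic x y 0 = x := by
  symm
  apply C.eq_geodesic <;> simp [pathDist_self, clamp]

lemma geodesic_one (x y : T) : C.geodesic x y 1 = y := by
  symm
  apply C.eq_geodesic <;> simp [pathDist_self, clamp]

lemma continuous_pathDist : Continuous fun p : T × T => C.pathDist p.1 p.2 := by
  refine continuous_iff_continuousAt.2 fun ⟨x, y⟩ => Metric.tendsto_nhds.2 fun η hη => ?_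
  have hev : ∀ x : T, ∀ᶠ q in 𝓝 x, C.pathDist x q < η / 2 := fun x =>
    (C.continuous_pathDist_right x).continuousAt.eventually_lt_const
      (by rw [pathDist_self]; linarith)
  rw [nhds_prod_eq]
  filter_upwards [(hev x).prod_mk (hev y)] with ⟨x', y'⟩ ⟨h1, h2⟩
  simp only at h1 h2 ⊢
  rw [Real.dist_eq, abs_lt]
  have a1 := C.pathDist_triangle x' x y'
  have a2 := C.pathDist_triangle x y y'
  have a3 := C.pathDist_triangle x x' y
  have a4 := C.pathDist_triangle x' y' y
  have a5 := C.pathDist_comm x x'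
  have a6 := C.pathDist_comm y y'
  constructor <;> linarith

/-- Geodesics depend continuously on their end points in the path metric. -/
lemma eventually_pathDist_geodesic_lt (x y : T) (t : ℝ) {η : ℝ} (hη : 0 < η) :
    ∀ᶠ q : T × T × ℝ in 𝓝 (x, y, t),
      C.pathDist (C.geodesic q.1 q.2.1 q.2.2) (C.geodesic x y t) < η := by
  have hd := C.continuous_pathDist
  have hc := continuous_clamp
  -- By the tripod property, the old point lies between the new one and `x`, or between the new one
  -- and `y`. The distance is then at most the function of `c1`, respectively `c2`, and both vanish
  -- at `(x, y, t)`.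
  have c1 : Continuous fun q : T × T × ℝ =>
      C.pathDist x q.1 + clamp q.2.2 * C.pathDist q.1 q.2.1 - clamp t * C.pathDist x y := by
    refine Continuous.sub (Continuous.add ?_ (Continuous.mul ?_ ?_)) continuous_const
    · exact (C.continuous_pathDist_right x).comp continuous_fst
    · exact hc.comp (by fun_prop)
    · exact hd.comp (by fun_prop : Continuous fun q : T × T × ℝ => (q.1, q.2.1))
  have c2 : Continuous fun q : T × T × ℝ => C.pathDist y q.2.1 +
      (1 - clamp q.2.2) * C.pathDist q.1 q.2.1 - (1 - clamp t) * C.pathDist x y := by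
    refine Continuous.sub (Continuous.add ?_ (Continuous.mul ?_ ?_)) continuous_const
    · exact (C.continuous_pathDist_right y).comp (by fun_prop)
    · exact continuous_const.sub (hc.comp (by fun_prop))
    · exact hd.comp (by fun_prop : Continuous fun q : T × T × ℝ => (q.1, q.2.1))
  have e1 := (c1.tendsto (x, y, t)).eventually_lt_const (u := η)
    (by simpa [pathDist_self] using hη)
  have e2 := (c2.tendsto (x, y, t)).eventually_lt_const (u := η)
    (by simpa [pathDist_self] using hη)
  filter_upwards [e1, e2] with ⟨x', y', t'⟩ h1 h2
  simp only at h1 h2 ⊢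
  set z' := C.geodesic x' y' t'
  rcases (C.between_geodesic x y t).or z' with h | h
  · have h := C.between_iff.1 h
    rw [C.pathDist_comm _ x, C.pathDist_geodesic, C.pathDist_comm _ x] at h
    have a := C.pathDist_triangle x x' z'
    rw [C.pathDist_geodesic] at a
    linarith
  · have h := C.between_iff.1 h
    rw [C.pathDist_geodesic_right] at h
    have a := C.pathDist_triangle z' y' y
    rw [C.pathDist_geodesic_right, C.pathDist_comm y' y] at a
    linarith

/-- Only finitely many coordinates differ between `x` and `y`; these are controlled by continuity in
the path metric. In all others `x`, `y` and the geodesic point agree, and convexity of boxes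
suffices. -/
theorem continuous_geodesic : Continuous fun q : T × T × ℝ => C.geodesic q.1 q.2.1 q.2.2 := by
  refine continuous_iff_continuousAt.2 fun ⟨x, y, t⟩ => ?_
  intro U hU
  obtain ⟨V, hVU, hV, hz⟩ := mem_nhds_iff.1 hU
  obtain ⟨ε, hε, hbox⟩ := C.exists_box_subset hV hz
  refine Filter.mem_map.2 (Filter.mem_of_superset ?_ (preimage_mono (hbox.trans hVU)))
  obtain ⟨η, hη, hηε⟩ : ∃ η > 0, ∀ e, C.coord e x ≠ C.coord e y → η ≤ ε e := by
    obtain ⟨S, hS⟩ := C.exists_finset_coord_eq x y y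
    have hpos : ∀ S : Finset E, ∃ η > 0, ∀ e ∈ S, η ≤ ε e := by
      classical
      intro S
      induction S using Finset.induction with
      | empty => exact ⟨1, one_pos, by simp⟩
      | insert a S _ ih =>
        obtain ⟨η, h1, h2⟩ := ih
        refine ⟨min η (ε a), lt_min h1 (hε a), fun e he => ?_⟩
        rcases Finset.mem_insert.1 he with rfl | he
        · exact min_le_right _ _
        · exact (min_le_left _ _).trans (h2 e he)
    obtain ⟨η, h1, h2⟩ := hpos S
    refine ⟨η, h1, fun e he => h2 e ?_⟩
    by_contra hh
    exact he ((hS e hh).1)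
  have hx : ∀ᶠ q : T × T × ℝ in 𝓝 (x, y, t), q.1 ∈ C.box x ε :=
    continuousAt_fst.eventually_mem ((C.isOpen_box x ε).mem_nhds (C.mem_box_self hε))
  have hy : ∀ᶠ q : T × T × ℝ in 𝓝 (x, y, t), q.2.1 ∈ C.box y ε :=
    (continuousAt_fst.comp continuousAt_snd).eventually_mem
      ((C.isOpen_box y ε).mem_nhds (C.mem_box_self hε))
  filter_upwards [C.eventually_pathDist_geodesic_lt x y t hη, hx, hy] with ⟨x', y', t'⟩ h1 h2 h3
  intro e
  simp only at h1 h2 h3 ⊢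
  by_cases hxy : C.coord e x = C.coord e y
  · have hz := abs_add_abs_eq_iff.1 (C.between_geodesic x y t e)
    have hz : C.coord e (C.geodesic x y t) = C.coord e x := by grind
    refine (C.between_geodesic x' y' t').mem_box ?_ ?_
    · rw [hz]; exact h2 e
    · rw [hz, hxy]; exact h3 e
  · exact ((C.abs_coord_sub_le e _ _).trans_lt h1).trans_le (hηε e hxy)

end connected

end TreeCoordinates

namespace TreeCoordinates

variable {T E : Type*} [TopologicalSpace T] (C : TreeCoordinates T E)

/-! ### Group actions on trees -/

/-- The characteristic maps of the edges are compatible with the action of `G`. -/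
def IsEquivariant (G : Type*) [Group G] [MulAction G T] [MulAction G E] : Prop :=
  ∀ (g : G) (e : E) (s : ℝ), g • C.edge e s = C.edge (g • e) s

section action

variable {C} {G : Type*} [Group G] [MulAction G T] [MulAction G E] [PreconnectedSpace T]
  (hG : C.IsEquivariant G)

include hG

/-- A coordinate is determined by its values on its own edge and its constancy on the others, and
`G` respects both. -/
lemma coord_smul (g : G) (e : E) (x : T) : C.coord (g • e) (g • x) = C.coord e x := by
  refine C.mem_of_edges (A := {x | C.coord (g • e) (g • x) = C.coord e x})
    ⟨C.edge e 0, ?_⟩ (fun f s s' hs => ?_) x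
  · rw [mem_ofPred_eq, hG, C.coord_edge_self, C.coord_edge_self]
  · rw [mem_ofPred_eq, hG] at hs ⊢
    by_cases h : e = f
    · subst h; rw [C.coord_edge_self, C.coord_edge_self]
    · have h' : g • e ≠ g • f := fun h' => h (MulAction.injective g h')
      rw [C.coord_edge_of_ne _ _ h s' s, ← hs, C.coord_edge_of_ne _ _ h' s' s]

lemma pathDist_smul (g : G) (x y : T) : C.pathDist (g • x) (g • y) = C.pathDist x y := by
  unfold pathDist
  rw [← finsum_comp_equiv (MulAction.toPerm g)]
  exact finsum_congr fun e => by simp only [MulAction.toPerm_apply, coord_smul hG]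

lemma smul_geodesic (g : G) (x y : T) (t : ℝ) :
    g • C.geodesic x y t = C.geodesic (g • x) (g • y) t := by
  apply C.eq_geodesic
  · rw [pathDist_smul hG, pathDist_smul hG, C.pathDist_geodesic]
  · rw [pathDist_smul hG, pathDist_smul hG, C.pathDist_geodesic_right]

/-- The homotopy runs along geodesics. No condition on `Y` is needed, so this serves for both `E`
and `J`. -/
lemma gHomotopic {Y : Type*} [TopologicalSpace Y] [MulAction G Y] {f₀ f₁ : C(Y, T)}
    (h₀ : IsGMap G f₀) (h₁ : IsGMap G f₁) : GHomotopic G f₀ f₁ := by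
  refine ⟨{ toFun := fun p => C.geodesic (f₀ p.2) (f₁ p.2) p.1
            continuous_toFun := C.continuous_geodesic.comp
              (by fun_prop : Continuous fun p : unitInterval × Y => (f₀ p.2, f₁ p.2, (p.1 : ℝ)))
            map_zero_left := fun x => by simp [geodesic_zero]
            map_one_left := fun x => by simp [geodesic_one]
            prop' := fun t g x => ?_ }⟩
  simp only [ContinuousMap.coe_mk]
  rw [h₀, h₁, smul_geodesic hG]

/-- A compact group acting on a tree has a fixed point: the circumcenter of an orbit. -/
theorem exists_fixed_point [TopologicalSpace G] [ContinuousSMul G T] [Nonempty T]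
    {H : Subgroup G} (hH : IsCompact (H : Set G)) : ∃ m : T, ∀ h ∈ H, h • m = m := by
  obtain ⟨x⟩ := ‹Nonempty T›
  have hcont : Continuous fun p : G × G => C.pathDist (p.1 • x) (p.2 • x) :=
    C.continuous_pathDist.comp
      (by fun_prop : Continuous fun p : G × G => (p.1 • x, p.2 • x))
  -- The points `a • x` and `b • x` realize the diameter of the orbit under `H`; the fixed point is
  -- their midpoint.
  obtain ⟨⟨a, b⟩, ⟨ha, hb⟩, hmax⟩ := (hH.prod hH).exists_isMaxOn
    ⟨(1, 1), H.one_mem, H.one_mem⟩ hcont.continuousOn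
  set D := C.pathDist (a • x) (b • x) with hD
  have hle : ∀ g ∈ H, ∀ h ∈ H, C.pathDist (g • x) (h • x) ≤ D := fun g hg h hh =>
    hmax (a := (g, h)) ⟨hg, hh⟩
  have hc : clamp (1 / 2) = 1 / 2 := clamp_of_mem (by norm_num)
  set m := C.geodesic (a • x) (b • x) (1 / 2) with hm
  have hma : C.pathDist (a • x) m = D / 2 := by rw [hm, C.pathDist_geodesic, hc]; ring
  have hmb : C.pathDist m (b • x) = D / 2 := by rw [hm, C.pathDist_geodesic_right, hc]; ring
  have hmo : ∀ g ∈ H, C.pathDist (g • x) m ≤ D / 2 := by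
    intro g hg
    rcases (C.between_geodesic (a • x) (b • x) (1 / 2)).or (g • x) with h | h
    · have h := C.between_iff.1 h
      rw [C.pathDist_comm _ (a • x), ← hm, hma] at h
      linarith [hle g hg a ha]
    · have h := C.between_iff.1 h
      rw [← hm, hmb] at h
      linarith [hle g hg b hb]
  refine ⟨m, fun h hh => ?_⟩
  have key : ∀ g ∈ H, C.pathDist (g • x) (h • m) ≤ D / 2 := fun g hg => by
    have := hmo (h⁻¹ * g) (H.mul_mem (H.inv_mem hh) hg)
    rwa [← pathDist_smul hG h, smul_smul, mul_inv_cancel_left] at this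
  have h1 := key a ha
  have h2 := key b hb
  rw [C.pathDist_comm] at h2
  -- A point within `D / 2` of both ends of a geodesic of length `D` is its midpoint.
  have h3 := C.pathDist_triangle (a • x) (h • m) (b • x)
  rw [hm]
  apply C.eq_geodesic <;> rw [hc] <;> linarith

end action

/-! ### Combining maps by a partition of unity -/

section combine

variable [PreconnectedSpace T] {ι : Type*}

/-- Starting from `z`, move successively towards the points `φ i`. -/
noncomputable def combine (φ : ι → T) (t : ι → ℝ) (l : List ι) (z : T) : T :=
  l.foldl (fun z i => C.geodesic z (φ i) (t i)) z

/-- A step of weight zero does not move, so the list may be enlarged to one that is constant near a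
given point of the source. -/
lemma combine_filter (φ : ι → T) (t : ι → ℝ) (l : List ι) (z : T) (p : ι → Bool)
    (hp : ∀ i, p i = false → t i = 0) : C.combine φ t (l.filter p) z = C.combine φ t l z := by
  unfold combine
  rw [List.foldl_filter]
  congr 1
  funext z i
  split_ifs with h
  · rfl
  · rw [hp i (by simpa using h), geodesic_zero]

/-- A step of weight one jumps to its target and forgets the past. This yields equivariance although
the starting point is not fixed by the group. -/
lemma combine_eq_of_exists_one (φ : ι → T) (t : ι → ℝ) {l : List ι} (h : ∃ i ∈ l, t i = 1)
    (z z' : T) : C.combine φ t l z = C.combine φ t l z' := by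
  induction l generalizing z z' with
  | nil => simp at h
  | cons i l ih =>
    unfold combine
    rw [List.foldl_cons, List.foldl_cons]
    rcases em (t i = 1) with h1 | h1
    · rw [h1, geodesic_one, geodesic_one]
    · refine ih ?_ _ _
      obtain ⟨j, hj, hj1⟩ := h
      rcases List.mem_cons.1 hj with rfl | hj
      · exact absurd hj1 h1
      · exact ⟨j, hj, hj1⟩

variable {C} in
lemma smul_combine {G : Type*} [Group G] [MulAction G T] [MulAction G E]
    (hG : C.IsEquivariant G) (g : G) {φ φ' : ι → T} (t : ι → ℝ) {l : List ι}
    (h : ∀ i ∈ l, φ' i = g • φ i) (z : T) :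
    g • C.combine φ t l z = C.combine φ' t l (g • z) := by
  induction l generalizing z with
  | nil => rfl
  | cons i l ih =>
    unfold combine
    rw [List.foldl_cons, List.foldl_cons, h i (by simp), ← smul_geodesic hG]
    exact ih (fun j hj => h j (by simp [hj])) _

lemma continuousAt_combine {Y : Type*} [TopologicalSpace Y] {y : Y} {φ : Y → ι → T}
    {t : Y → ι → ℝ} {l : List ι} (hφ : ∀ i ∈ l, ContinuousAt (fun y => φ y i) y)
    (ht : ∀ i ∈ l, ContinuousAt (fun y => t y i) y) {z : Y → T} (hz : ContinuousAt z y) :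
    ContinuousAt (fun y => C.combine (φ y) (t y) l (z y)) y := by
  induction l generalizing z with
  | nil => exact hz
  | cons i l ih =>
    unfold combine
    simp only [List.foldl_cons]
    refine ih (fun j hj => hφ j (by simp [hj])) (fun j hj => ht j (by simp [hj])) ?_
    exact C.continuous_geodesic.continuousAt.comp (f := fun y => (z y, φ y i, t y i))
      (hz.prodMk ((hφ i (by simp)).prodMk (ht i (by simp))))

end combine

end TreeCoordinates

/-! ### Numerable spaces -/

namespace PartitionOfUnity

variable {ι Y : Type*} [TopologicalSpace Y] (e : PartitionOfUnity ι Y)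

/-- The largest value of the functions in a partition of unity. -/
noncomputable def maxValue (y : Y) : ℝ := ⨆ i, e i y

lemma exists_eq_maxValue (y : Y) : 0 < e.maxValue y ∧ ∃ i, e i y = e.maxValue y := by
  obtain ⟨i, hi⟩ := e.exists_pos (mem_univ y)
  have hbdd : BddAbove (range fun i => e i y) := ⟨1, by rintro _ ⟨i, rfl⟩; exact e.le_one i y⟩
  have hne : (e.finsupport y).Nonempty := ⟨i, (e.mem_finsupport y).2 hi.ne'⟩
  obtain ⟨j, hj, hmax⟩ := (e.finsupport y).exists_max_image (fun i => e i y) hne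
  refine ⟨hi.trans_le (le_ciSup hbdd i), j, le_antisymm (le_ciSup hbdd j) ?_⟩
  have : Nonempty ι := ⟨i⟩
  refine ciSup_le fun k => ?_
  by_cases hk : k ∈ e.finsupport y
  · exact hmax k hk
  · have : e k y = 0 := by simpa [e.mem_finsupport] using hk
    rw [this]
    exact e.nonneg j y

/-- Locally the supremum runs over a fixed finite set of indices. -/
lemma continuous_maxValue : Continuous e.maxValue := by
  refine continuous_iff_continuousAt.2 fun y => ?_
  obtain ⟨-, i, -⟩ := e.exists_eq_maxValue y
  have hbdd : ∀ y, BddAbove (range fun i => e i y) := fun y =>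
    ⟨1, by rintro _ ⟨i, rfl⟩; exact e.le_one i y⟩
  have : Nonempty ι := ⟨i⟩
  classical
  set S := insert i (e.fintsupport y) with hS
  have hne : S.Nonempty := ⟨i, by simp [hS]⟩
  have hcont : Continuous fun y => S.sup' hne fun i => e i y :=
    Continuous.finset_sup'_apply hne fun i _ => (e i).continuous
  refine hcont.continuousAt.congr ?_
  filter_upwards [e.eventually_finsupport_subset y] with y' hy'
  apply le_antisymm
  · exact Finset.sup'_le _ _ fun i _ => le_ciSup (hbdd y') i
  · refine ciSup_le fun k => ?_
    by_cases hk : k ∈ S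
    · exact Finset.le_sup' (fun i => e i y') hk
    · have hk' : k ∉ e.finsupport y' := fun h => hk (by rw [hS]; simp [hy' h])
      have : e k y' = 0 := by simpa [e.mem_finsupport] using hk'
      rw [this]
      exact (e.nonneg i y').trans (Finset.le_sup' (fun i => e i y') (by simp [hS]))

end PartitionOfUnity

/-! ### Maps out of homogeneous spaces -/

section orbitMap

variable {G T : Type*} [Group G] [TopologicalSpace G] [TopologicalSpace T] [MulAction G T]
  [ContinuousSMul G T]

/-- A point fixed by `H` gives a `G`-map from `G ⧸ H`. -/
lemma exists_quotient_map {H : Subgroup G} {m : T} (hm : ∀ h ∈ H, h • m = m) :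
    ∃ ψ : G ⧸ H → T, Continuous ψ ∧ ∀ g : G, ψ (g : G ⧸ H) = g • m := by
  refine ⟨fun c => c.out • m, ?_, ?_⟩
  · refine (QuotientGroup.isQuotientMap_mk H).continuous_iff.2 ?_
    have : (fun c : G ⧸ H => c.out • m) ∘ QuotientGroup.mk = fun g : G => g • m := by
      funext g
      obtain ⟨h, hh⟩ := QuotientGroup.mk_out_eq_mul H g
      rw [Function.comp_apply, hh, mul_smul, hm h h.2]
    rw [this]
    fun_prop
  · intro g
    obtain ⟨h, hh⟩ := QuotientGroup.mk_out_eq_mul H g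
    simp only
    rw [hh, mul_smul, hm h h.2]

omit [TopologicalSpace G] [TopologicalSpace T] [ContinuousSMul G T] in
lemma quotient_map_smul {H : Subgroup G} {m : T} {ψ : G ⧸ H → T}
    (hψ : ∀ g : G, ψ (g : G ⧸ H) = g • m) (g : G) (c : G ⧸ H) : ψ (g • c) = g • ψ c := by
  induction c using QuotientGroup.induction_on with
  | H c => rw [MulAction.Quotient.smul_coe, hψ, hψ, smul_eq_mul, mul_smul]

end orbitMap

namespace TreeCoordinates

variable {T E : Type*} [TopologicalSpace T] {C : TreeCoordinates T E}

/-- Fixed points of compact groups give `G`-maps on the sets `U i`. They are mixed along geodesics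
in the order of the indices, with weights divided by their maximum so that one weight is always `1`.
-/
theorem exists_isGMap_of_isNumerable {G : Type*} [Group G] [TopologicalSpace G] [MulAction G T]
    [MulAction G E] [PreconnectedSpace T] [Nonempty T] [ContinuousSMul G T]
    (hG : C.IsEquivariant G) (F : SubgroupFamily G)
    (hF : ∀ H ∈ F.carrier, IsCompact (H : Set G)) {Y : Type*} [TopologicalSpace Y] [MulAction G Y]
    (hY : IsNumerable F Y) : ∃ f : C(Y, T), IsGMap G f := by
  classical
  obtain ⟨ι, U, e, hUo, hUG, -, hUφ, hsub, heG⟩ := hY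
  obtain ⟨z₀⟩ := ‹Nonempty T›
  have : Nonempty T := ⟨z₀⟩
  have hloc : ∀ i, ∃ f : Y → T, ContinuousOn f (U i) ∧
      ∀ (g : G), ∀ y ∈ U i, f (g • y) = g • f y := by
    intro i
    obtain ⟨H, hH, φ, hφ, hφG⟩ := hUφ i
    obtain ⟨m, hm⟩ := exists_fixed_point hG (hF H hH)
    obtain ⟨ψ, hψ, hψm⟩ := exists_quotient_map hm
    refine ⟨fun y => if h : y ∈ U i then ψ (φ ⟨y, h⟩) else z₀, ?_, fun g y hy => ?_⟩
    · rw [continuousOn_iff_continuous_domRestrict]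
      refine (hψ.comp hφ).congr fun y => ?_
      simp
    · simp only [hy, hUG i g y hy, dif_pos]
      rw [hφG g ⟨y, hy⟩ ⟨g • y, hUG i g y hy⟩ rfl, quotient_map_smul hψm]
  choose f hf hfG using hloc
  -- One order on all indices makes the order of mixing independent of the point.
  let : LinearOrder ι := linearOrderOfSTO (WellOrderingRel (α := ι))
  set t : Y → ι → ℝ := fun y i => e i y / e.maxValue y with ht
  have hMpos : ∀ y, e.maxValue y ≠ 0 := fun y => (e.exists_eq_maxValue y).1.ne'
  have htc : ∀ i, Continuous fun y => t y i := fun i =>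
    (e i).continuous.div e.continuous_maxValue hMpos
  have ht0 : ∀ y i, i ∉ e.finsupport y → t y i = 0 := by
    intro y i hi
    have : e i y = 0 := by simpa [e.mem_finsupport] using hi
    simp [ht, this]
  have hMG : ∀ (g : G) y, e.maxValue (g • y) = e.maxValue y := fun g y => by
    simp only [PartitionOfUnity.maxValue, heG]
  have htG : ∀ (g : G) y, t (g • y) = t y := fun g y => by
    funext i
    simp only [ht, heG, hMG]
  have hsuppG : ∀ (g : G) y, e.finsupport (g • y) = e.finsupport y := fun g y => by
    ext i
    simp only [e.mem_finsupport, Function.mem_support, heG]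
  have hU : ∀ y, ∀ i ∈ e.finsupport y, y ∈ U i := fun y i hi =>
    hsub i (subset_tsupport _ ((e.mem_finsupport y).1 hi))
  have hone : ∀ y, ∃ i ∈ (e.finsupport y).sort, t y i = 1 := by
    intro y
    obtain ⟨hpos, i, hi⟩ := e.exists_eq_maxValue y
    refine ⟨i, ?_, ?_⟩
    · rw [Finset.mem_sort, e.mem_finsupport, Function.mem_support, hi]
      exact hpos.ne'
    · simp only [ht, hi]
      exact div_self hpos.ne'
  set Fm : Y → T := fun y => C.combine (fun i => f i y) (t y) (e.finsupport y).sort z₀ with hFm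
  have hsort : ∀ y (S : Finset ι), e.finsupport y ⊆ S →
      Fm y = C.combine (fun i => f i y) (t y) S.sort z₀ := by
    intro y S hS
    rw [← C.combine_filter _ _ (S.sort (· ≤ ·)) z₀ (fun i => decide (i ∈ e.finsupport y))
      (fun i hi => ht0 y i (by simpa using hi))]
    have hnd := (S.sort_nodup (· ≤ ·)).filter (fun i => decide (i ∈ e.finsupport y))
    have hpw := (S.pairwise_sort (· ≤ ·)).filter (fun i => decide (i ∈ e.finsupport y))
    have := (List.toFinset_sort (· ≤ ·) hnd).2 hpw
    rw [← this]
    simp only [hFm]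
    congr 2
    ext i
    simp only [List.mem_toFinset, List.mem_filter, Finset.mem_sort, decide_eq_true_eq]
    exact ⟨fun h => ⟨hS h, h⟩, fun h => h.2⟩
  have hcont : Continuous Fm := by
    refine continuous_iff_continuousAt.2 fun y => ?_
    -- With the fixed list of indices whose closed supports contain `y`, every map involved is
    -- continuous at `y`.
    have h1 : ContinuousAt (fun y' => C.combine (fun i => f i y') (t y') (e.fintsupport y).sort z₀)
        y := by
      refine C.continuousAt_combine (fun i hi => ?_) (fun i _ => (htc i).continuousAt)
        continuousAt_const
      have hi : y ∈ U i := hsub i ((e.mem_fintsupport_iff y i).1 ((Finset.mem_sort _).1 hi))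
      exact (hf i).continuousAt ((hUo i).mem_nhds hi)
    refine h1.congr ?_
    filter_upwards [e.eventually_finsupport_subset y] with y' hy'
    exact (hsort y' _ hy').symm
  refine ⟨⟨Fm, hcont⟩, fun g y => ?_⟩
  simp only [ContinuousMap.coe_mk, hFm]
  rw [smul_combine hG g (φ' := fun i => f i (g • y)), hsuppG, htG]
  -- The two sides start at `g • z₀` and `z₀`; a weight equal to one removes the difference.
  · exact C.combine_eq_of_exists_one _ _ (hone y) _ _
  · intro i hi
    exact hfG i g y (hU y i ((Finset.mem_sort _).1 hi))

end TreeCoordinates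

/-! ### Equivariant maps out of `G`-CW-complexes -/

/-- A map into the points fixed by `H` extends to a `G`-map. -/
lemma exists_quotient_prod_map {G T D : Type*} [Group G] [TopologicalSpace G]
    [IsTopologicalGroup G] [TopologicalSpace T] [MulAction G T] [ContinuousSMul G T]
    [TopologicalSpace D] {H : Subgroup G} {f : D → T} (hf : Continuous f)
    (hH : ∀ h ∈ H, ∀ d, h • f d = f d) :
    ∃ ψ : (G ⧸ H) × D → T, Continuous ψ ∧ ∀ (g : G) d, ψ ((g : G ⧸ H), d) = g • f d := by
  have key : ∀ (g : G) d, (g : G ⧸ H).out • f d = g • f d := fun g d => by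
    obtain ⟨h, hh⟩ := QuotientGroup.mk_out_eq_mul H g
    rw [hh, mul_smul, hH h h.2]
  refine ⟨fun p => p.1.out • f p.2, ?_, key⟩
  -- The projection to `G ⧸ H` is open, so its product with `D` is still a quotient map.
  rw [← ((QuotientGroup.isOpenQuotientMap_mk (N := H)).prodMap
    (IsOpenQuotientMap.id (X := D))).continuous_comp_iff]
  have : (fun p : (G ⧸ H) × D => p.1.out • f p.2) ∘ Prod.map QuotientGroup.mk id =
      fun p : G × D => p.1 • f p.2 := by
    funext p
    exact key p.1 p.2
  rw [this]
  fun_prop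

lemma norm_inv_norm_smul {V : Type*} [NormedAddCommGroup V] [NormedSpace ℝ V] {d : V}
    (hd : d ≠ 0) : ‖‖d‖⁻¹ • d‖ = 1 := by
  rw [norm_smul, norm_inv, norm_norm, inv_mul_cancel₀ (norm_ne_zero_iff.2 hd)]

namespace TreeCoordinates

variable {T E : Type*} [TopologicalSpace T] (C : TreeCoordinates T E)

/-! ### Filling spheres by geodesic cones -/

section cone

variable [PreconnectedSpace T] {V : Type*} [NormedAddCommGroup V] [NormedSpace ℝ V]

/-- The extension of a map from the unit sphere along geodesics to `m`. -/
noncomputable def cone (m : T) (φ : V → T) (d : V) : T := C.geodesic m (φ (‖d‖⁻¹ • d)) ‖d‖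

lemma cone_of_norm_eq_one (m : T) (φ : V → T) {d : V} (hd : ‖d‖ = 1) : C.cone m φ d = φ d := by
  simp [cone, hd, geodesic_one]

/-- At the origin the rescaled vector is the default `0`, but at time zero the geodesic ignores its
end point. -/
lemma cone_zero (m : T) (φ : V → T) : C.cone m φ 0 = m := by
  simp [cone, geodesic_zero]

lemma continuous_cone [FiniteDimensional ℝ V] (m : T) {φ : V → T}
    (hφ : ContinuousOn φ (Metric.sphere 0 1)) : Continuous (C.cone m φ) := by
  have hmaps : ∀ d : V, d ≠ 0 → ‖d‖⁻¹ • d ∈ Metric.sphere (0 : V) 1 := fun d hd => by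
    rw [mem_sphere_zero_iff_norm, norm_inv_norm_smul hd]
  refine continuous_iff_continuousAt.2 fun d => ?_
  by_cases hd : d = 0
  · subst hd
    have := FiniteDimensional.proper ℝ V
    rw [ContinuousAt, cone_zero]
    intro U hU
    obtain ⟨W, hWU, hW, hm⟩ := mem_nhds_iff.1 hU
    have hc : Continuous fun p : ℝ × Metric.sphere (0 : V) 1 => C.geodesic m (φ p.2) p.1 := by
      have h1 : Continuous fun p : ℝ × Metric.sphere (0 : V) 1 => φ p.2 :=
        hφ.comp_continuous (by fun_prop) fun p => p.2.2
      exact C.continuous_geodesic.comp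
        (continuous_const.prodMk (h1.prodMk continuous_fst) :
          Continuous fun p : ℝ × Metric.sphere (0 : V) 1 => (m, φ p.2, p.1))
    -- At the origin the direction has no limit; compactness of the sphere makes the convergence to
    -- `m` uniform in the direction.
    obtain ⟨a, b, ha, -, h0a, hb, hab⟩ := generalized_tube_lemma (isCompact_singleton (x := (0 : ℝ)))
      (isCompact_univ (X := Metric.sphere (0 : V) 1)) (hW.preimage hc) (by
        rintro ⟨r, u⟩ ⟨hr, -⟩
        rw [mem_singleton_iff] at hr
        simp only at hr
        subst hr
        simpa [geodesic_zero] using hm)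
    have hev : ∀ᶠ d : V in 𝓝 0, ‖d‖ ∈ a :=
      (continuous_norm.tendsto' (0 : V) 0 norm_zero).eventually_mem (ha.mem_nhds (h0a rfl))
    rw [Filter.mem_map]
    filter_upwards [hev] with d hd
    refine hWU ?_
    by_cases hd0 : d = 0
    · rw [hd0, cone_zero]; exact hm
    · exact hab (a := (‖d‖, ⟨_, hmaps d hd0⟩)) ⟨hd, hb trivial⟩
  · have hopen : IsOpen ({0}ᶜ : Set V) := isOpen_compl_singleton
    have h1 : ContinuousAt (fun d : V => φ (‖d‖⁻¹ • d)) d := by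
      refine ContinuousOn.continuousAt ?_ (hopen.mem_nhds hd)
      refine hφ.comp ?_ hmaps
      refine ContinuousOn.smul (ContinuousOn.inv₀ continuous_norm.continuousOn ?_) continuousOn_id
      exact fun d hd => norm_ne_zero_iff.2 hd
    exact C.continuous_geodesic.continuousAt.comp (f := fun d => (m, φ (‖d‖⁻¹ • d), ‖d‖))
      (continuousAt_const.prodMk (h1.prodMk continuous_norm.continuousAt))

end cone

variable {C} {G : Type*} [Group G] [TopologicalSpace G] [IsTopologicalGroup G] [MulAction G T]
  [MulAction G E] [PreconnectedSpace T] [Nonempty T] [ContinuousSMul G T]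
  (hG : C.IsEquivariant G)

include hG

/-- The points fixed by `H` are closed under geodesics, so the cone from a fixed point over the
boundary values stays fixed by `H`. For `n = 0` the boundary is empty and only the fixed point
remains. -/
lemma exists_cell_map {H : Subgroup G} (hH : IsCompact (H : Set G)) {n : ℕ} {φ : Disk n → T}
    (hφ : ContinuousOn φ {d | ‖d.1‖ = 1}) (hφH : ∀ h ∈ H, ∀ d, ‖d.1‖ = 1 → h • φ d = φ d) :
    ∃ ψ : (G ⧸ H) × Disk n → T, Continuous ψ ∧
      (∀ (g : G) c d, ψ (g • c, d) = g • ψ (c, d)) ∧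
      ∀ (g : G) d, ‖d.1‖ = 1 → ψ ((g : G ⧸ H), d) = g • φ d := by
  classical
  obtain ⟨m, hm⟩ := exists_fixed_point hG hH
  set φ' : EuclideanSpace ℝ (Fin n) → T := fun d =>
    if h : d ∈ Metric.closedBall (0 : EuclideanSpace ℝ (Fin n)) 1 then φ ⟨d, h⟩ else m with hφ'
  have hφ'1 : ∀ d : Disk n, φ' d.1 = φ d := fun d => dif_pos d.2
  have hφc : ContinuousOn φ' (Metric.sphere 0 1) := by
    rw [continuousOn_iff_continuous_domRestrict]
    have : Continuous fun d : Metric.sphere (0 : EuclideanSpace ℝ (Fin n)) 1 =>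
        φ ⟨d.1, Metric.sphere_subset_closedBall d.2⟩ :=
      hφ.comp_continuous (by fun_prop) fun d => by simp
    exact this.congr fun d => (hφ'1 ⟨d.1, Metric.sphere_subset_closedBall d.2⟩).symm
  have hfix : ∀ h ∈ H, ∀ d : EuclideanSpace ℝ (Fin n), h • C.cone m φ' d = C.cone m φ' d := by
    intro h hh d
    by_cases hd : d = 0
    · rw [hd, cone_zero, hm h hh]
    · have h1 : ‖‖d‖⁻¹ • d‖ = 1 := norm_inv_norm_smul hd
      have h2 : ‖d‖⁻¹ • d ∈ Metric.closedBall (0 : EuclideanSpace ℝ (Fin n)) 1 := by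
        rw [mem_closedBall_zero_iff, h1]
      rw [cone, smul_geodesic hG, hm h hh, hφ'1 ⟨_, h2⟩, hφH h hh ⟨_, h2⟩ h1]
  obtain ⟨ψ, hψ, hψg⟩ := exists_quotient_prod_map (H := H) (f := fun d : Disk n => C.cone m φ' d.1)
    ((C.continuous_cone m hφc).comp continuous_subtype_val) fun h hh d => hfix h hh d.1
  refine ⟨ψ, hψ, fun g c d => ?_, fun g d hd => ?_⟩
  · induction c using QuotientGroup.induction_on with
    | H c => rw [MulAction.Quotient.smul_coe, hψg, hψg, smul_eq_mul, mul_smul]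
  · rw [hψg, C.cone_of_norm_eq_one _ _ hd, hφ'1]

lemma exists_extension_of_attachesEquivariantCells {Y : Type*} [TopologicalSpace Y] [T2Space Y]
    [MulAction G Y] [ContinuousSMul G Y] (hY : ∀ y : Y, IsCompact (MulAction.stabilizer G y : Set G))
    {n : ℕ} {A B : Set Y} (hA : ∀ (g : G), ∀ y ∈ A, g • y ∈ A)
    (hatt : AttachesEquivariantCells G n A B) {f : Y → T} (hf : ContinuousOn f A)
    (hfG : ∀ (g : G), ∀ y ∈ A, f (g • y) = g • f y) :
    ∃ f' : Y → T, EqOn f f' A ∧ ContinuousOn f' B ∧ ∀ (g : G), ∀ y ∈ B, f' (g • y) = g • f' y := by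
  classical
  obtain ⟨ι, H, Q, hHc, hQ, hQG, hQA, hbij, hcl⟩ := hatt
  have hcell : ∀ i, ∃ ψ : (G ⧸ H i) × Disk n → T, Continuous ψ ∧
      (∀ (g : G) c d, ψ (g • c, d) = g • ψ (c, d)) ∧
      ∀ (g : G) d, ‖d.1‖ = 1 → ψ ((g : G ⧸ H i), d) = g • f (Q i (((1 : G) : G ⧸ H i), d)) := by
    intro i
    have hfix : ∀ h ∈ H i, ∀ d, h • Q i (((1 : G) : G ⧸ H i), d) = Q i (((1 : G) : G ⧸ H i), d) := by
      intro h hh d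
      rw [← hQG]
      congr 2
      rw [MulAction.Quotient.smul_coe, QuotientGroup.eq]
      simpa using hh
    -- The group of a cell is a closed subgroup of the compact stabilizer of its center.
    have hcomp : IsCompact (H i : Set G) :=
      (hY (Q i (((1 : G) : G ⧸ H i), ⟨0, by simp⟩))).of_isClosed_subset (hHc i)
        fun h hh => hfix h hh _
    refine exists_cell_map hG hcomp ?_ fun h hh d hd => ?_
    · refine hf.comp (Continuous.continuousOn ?_) fun d hd => hQA i _ d hd
      exact (hQ i).comp (by fun_prop)
    · rw [← hfG h _ (hQA i _ d hd), hfix h hh]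
  choose ψ hψ hψG hψb using hcell
  have hbd : ∀ i c d, ‖d.1‖ = 1 → ψ i (c, d) = f (Q i (c, d)) := by
    intro i c d hd
    induction c using QuotientGroup.induction_on with
    | H g =>
      rw [hψb i g d hd, ← hfG g _ (hQA i _ d hd), ← hQG, MulAction.Quotient.smul_coe, smul_eq_mul,
        mul_one]
  -- Off `A`, a point of `B` has a unique preimage in the interiors of the cells. Outside `B` the
  -- value is immaterial.
  set f' : Y → T := fun y => if y ∈ A then f y else
    if h : ∃ p : Σ i, (G ⧸ H i) × Disk n, ‖p.2.2.1‖ < 1 ∧ Q p.1 p.2 = y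
      then ψ h.choose.1 h.choose.2 else f y with hf'
  have hfA : ∀ y ∈ A, f' y = f y := fun y hy => if_pos hy
  have hf'Q : ∀ i c d, f' (Q i (c, d)) = ψ i (c, d) := by
    intro i c d
    have hle : ‖d.1‖ ≤ 1 := mem_closedBall_zero_iff.1 d.2
    rcases hle.lt_or_eq with hd | hd
    · have hB := hbij.mapsTo (x := ⟨i, c, d⟩) hd
      have hex : ∃ p : Σ i, (G ⧸ H i) × Disk n, ‖p.2.2.1‖ < 1 ∧ Q p.1 p.2 = Q i (c, d) :=
        ⟨⟨i, c, d⟩, hd, rfl⟩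
      have heq : hex.choose = ⟨i, c, d⟩ :=
        hbij.injOn hex.choose_spec.1 hd hex.choose_spec.2
      simp only [hf']
      rw [if_neg hB.2, dif_pos hex, heq]
    · rw [hfA _ (hQA i c d hd), hbd i c d hd]
  refine ⟨f', fun y hy => (hfA y hy).symm, ?_, fun g y hy => ?_⟩
  · rw [continuousOn_iff_continuous_domRestrict]
    refine continuous_iff_isClosed.2 fun K hK => (hcl (f' ⁻¹' K)).2 ⟨?_, fun i => ?_⟩
    · have h1 : Continuous (A.domRestrict f) := continuousOn_iff_continuous_domRestrict.1 hf
      convert hK.preimage h1 using 1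
      ext y
      simp [hfA y y.2]
    · convert hK.preimage (hψ i) using 1
      ext ⟨c, d⟩
      simp [hf'Q]
  · by_cases hyA : y ∈ A
    · rw [hfA _ hyA, hfA _ (hA g y hyA), hfG g y hyA]
    · obtain ⟨⟨i, c, d⟩, -, hp⟩ := hbij.surjOn ⟨hy, hyA⟩
      simp only at hp
      rw [← hp, ← hQG, hf'Q, hf'Q, hψG]

theorem exists_isGMap_of_gcwStructure {Y : Type*} [TopologicalSpace Y] [T2Space Y]
    [MulAction G Y] [ContinuousSMul G Y] (hY : ∀ y : Y, IsCompact (MulAction.stabilizer G y : Set G))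
    (S : GCWStructure G Y) : ∃ f : C(Y, T), IsGMap G f := by
  classical
  obtain ⟨z₀⟩ := ‹Nonempty T›
  have : Nonempty T := ⟨z₀⟩
  let P : ℕ → (Y → T) → Prop := fun n f =>
    ContinuousOn f (S.skel n) ∧ ∀ (g : G), ∀ y ∈ S.skel n, f (g • y) = g • f y
  obtain ⟨f0, -, hf0⟩ := exists_extension_of_attachesEquivariantCells hG hY
    (fun _ _ h => h.elim) S.attach_zero (f := fun _ => z₀) (continuousOn_empty _)
    (fun _ _ h => h.elim)
  have hstep : ∀ n f, P n f → ∃ f', EqOn f f' (S.skel n) ∧ P (n + 1) f' := fun n f hf =>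
    exists_extension_of_attachesEquivariantCells hG hY (S.smul_mem n)
      (S.attach_succ n) hf.1 hf.2
  choose! next hnext using hstep
  let F : ℕ → Y → T := fun n => Nat.rec f0 (fun n f => next n f) n
  have hP : ∀ n, P n (F n) := fun n => by
    induction n with
    | zero => exact hf0
    | succ n ih => exact (hnext n _ ih).2
  have hsucc : ∀ n, EqOn (F n) (F (n + 1)) (S.skel n) := fun n => (hnext n _ (hP n)).1
  have hle : ∀ k n, k ≤ n → EqOn (F k) (F n) (S.skel k) := fun k n hkn => by
    induction n, hkn using Nat.le_induction with
    | base => exact fun _ _ => rfl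
    | succ n hkn ih => exact ih.trans ((hsucc n).mono (S.mono hkn))
  have hex : ∀ y : Y, ∃ n, y ∈ S.skel n := fun y =>
    mem_iUnion.1 (S.iUnion_skel.symm ▸ mem_univ y)
  -- Each stage agrees with the earlier ones on their skeleta, so the first stage containing `y` may
  -- decide its value.
  set f : Y → T := fun y => F (Nat.find (hex y)) y with hf
  have hfF : ∀ n, EqOn f (F n) (S.skel n) := fun n y hy =>
    hle _ _ (Nat.find_min' (hex y) hy) (Nat.find_spec (hex y))
  have hc : Continuous f := continuous_iff_isClosed.2 fun K hK => (S.isClosed_iff _).2 fun n => by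
    have h1 : Continuous ((S.skel n).domRestrict (F n)) :=
      continuousOn_iff_continuous_domRestrict.1 (hP n).1
    convert hK.preimage h1 using 1
    ext y
    simp [hfF n y.2]
  refine ⟨⟨f, hc⟩, fun g y => ?_⟩
  obtain ⟨n, hn⟩ := hex y
  simp only [ContinuousMap.coe_mk]
  rw [hfF n hn, hfF n (S.smul_mem n g y hn), (hP n).2 g y hn]

end TreeCoordinates

/-! ### One-dimensional complexes -/

/-- A one-dimensional CW-complex `T` with set of vertices `V`, given by the characteristic maps of
its edges, which are extended constantly to the real line. -/
structure EdgeMaps (T : Type*) [TopologicalSpace T] (V : Set T) (E : Type*) where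
  edge : E → ℝ → T
  continuous_edge : ∀ e, Continuous (edge e)
  edge_clamp : ∀ e s, edge e (clamp s) = edge e s
  edge_zero_mem : ∀ e, edge e 0 ∈ V
  edge_one_mem : ∀ e, edge e 1 ∈ V
  edge_notMem : ∀ e, ∀ s ∈ Ioo (0 : ℝ) 1, edge e s ∉ V
  edge_injective : ∀ e e', ∀ s ∈ Ioo (0 : ℝ) 1, ∀ s' ∈ Ioo (0 : ℝ) 1,
    edge e s = edge e' s' → e = e' ∧ s = s'
  exists_edge : ∀ x ∉ V, ∃ e, ∃ s ∈ Ioo (0 : ℝ) 1, edge e s = x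
  isClosed_of_edge : ∀ A : Set T, (∀ e, IsClosed (edge e ⁻¹' A)) → IsClosed A

lemma clamp_mem_Ioo {s : ℝ} : clamp s ∈ Ioo (0 : ℝ) 1 ↔ s ∈ Ioo (0 : ℝ) 1 := by
  unfold clamp
  simp only [mem_Ioo]
  grind

lemma clamp_eq_of_notMem_Ioo {s : ℝ} (h : s ∉ Ioo (0 : ℝ) 1) : clamp s = 0 ∨ clamp s = 1 := by
  simp only [mem_Ioo] at h
  unfold clamp
  grind

lemma clamp_clamp (s : ℝ) : clamp (clamp s) = clamp s := clamp_of_mem (clamp_mem s)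

lemma eq_of_continuous_of_isInt {h : ℝ → ℝ} (hc : Continuous h) (hi : ∀ s, ∃ n : ℤ, h s = n)
    (s s' : ℝ) : h s = h s' := by
  choose n hn using hi
  have hnc : Continuous n := by
    rw [Int.isClosedEmbedding_coe_real.isInducing.continuous_iff]
    exact hc.congr hn
  rw [hn, hn, PreconnectedSpace.constant inferInstance hnc (x := s) (y := s')]

namespace EdgeMaps

variable {T E : Type*} [TopologicalSpace T] {V : Set T} (M : EdgeMaps T V E)

/-- The open edge `e`. -/
def openEdge (e : E) : Set T := M.edge e '' Ioo 0 1

lemma edge_mem_of_notMem_Ioo (e : E) {s : ℝ} (hs : s ∉ Ioo (0 : ℝ) 1) : M.edge e s ∈ V := by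
  rw [← M.edge_clamp]
  rcases clamp_eq_of_notMem_Ioo hs with h | h <;> rw [h]
  · exact M.edge_zero_mem e
  · exact M.edge_one_mem e

lemma edge_mem_openEdge_iff {e f : E} {s : ℝ} :
    M.edge f s ∈ M.openEdge e ↔ f = e ∧ s ∈ Ioo (0 : ℝ) 1 := by
  constructor
  · rintro ⟨s', hs', h⟩
    by_cases hs : s ∈ Ioo (0 : ℝ) 1
    · exact ⟨(M.edge_injective _ _ _ hs' _ hs h).1.symm, hs⟩
    · exact absurd (h ▸ M.edge_mem_of_notMem_Ioo f hs) (M.edge_notMem e s' hs')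
  · rintro ⟨rfl, hs⟩
    exact mem_image_of_mem _ hs

lemma eq_of_mem_openEdge {e f : E} {x : T} (h : x ∈ M.openEdge e) (h' : x ∈ M.openEdge f) :
    e = f := by
  obtain ⟨s, hs, rfl⟩ := h
  exact (M.edge_mem_openEdge_iff.1 h').1

lemma isClosed_iff (A : Set T) : IsClosed A ↔ ∀ e, IsClosed (M.edge e ⁻¹' A) :=
  ⟨fun h e => h.preimage (M.continuous_edge e), M.isClosed_of_edge A⟩

lemma isOpen_openEdge (e : E) : IsOpen (M.openEdge e) := by
  rw [← isClosed_compl_iff, M.isClosed_iff]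
  intro f
  rw [preimage_compl, isClosed_compl_iff]
  by_cases h : f = e
  · have : M.edge f ⁻¹' M.openEdge e = Ioo 0 1 := by
      ext s; simp only [mem_preimage, M.edge_mem_openEdge_iff, h, true_and]
    rw [this]; exact isOpen_Ioo
  · have : M.edge f ⁻¹' M.openEdge e = ∅ := by
      ext s; simp only [mem_preimage, M.edge_mem_openEdge_iff, h, false_and, mem_empty_iff_false]
    rw [this]; exact isOpen_empty

lemma isPreconnected_openEdge (e : E) : IsPreconnected (M.openEdge e) :=
  isPreconnected_Ioo.image _ (M.continuous_edge e).continuousOn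

/-! #### Coordinates on contractible complexes -/

open Classical in
/-- The map to the circle that wraps the edge `e` around once and is constant elsewhere. -/
noncomputable def toCircle (e : E) (x : T) : AddCircle (1 : ℝ) :=
  if h : x ∈ M.openEdge e then (h.choose : ℝ) else 0

lemma toCircle_edge_self (e : E) (s : ℝ) : M.toCircle e (M.edge e s) = (clamp s : ℝ) := by
  unfold toCircle
  split_ifs with h
  · have hs := (M.edge_mem_openEdge_iff.1 h).2
    rw [(M.edge_injective _ _ _ h.choose_spec.1 _ hs h.choose_spec.2).2,
      clamp_of_mem (Ioo_subset_Icc_self hs)]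
  · rw [M.edge_mem_openEdge_iff] at h
    rcases clamp_eq_of_notMem_Ioo fun hs => h ⟨rfl, hs⟩ with h | h <;> rw [h]
    · rfl
    · exact (AddCircle.coe_period 1).symm

lemma toCircle_of_notMem {e : E} {x : T} (h : x ∉ M.openEdge e) : M.toCircle e x = 0 := dif_neg h

lemma continuous_toCircle (e : E) : Continuous (M.toCircle e) := by
  refine continuous_iff_isClosed.2 fun K hK => (M.isClosed_iff _).2 fun f => ?_
  rw [← preimage_comp]
  refine hK.preimage ?_
  by_cases h : f = e
  · subst h
    simp only [Function.comp_def, toCircle_edge_self]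
    exact (AddCircle.isCoveringMap_coe (1 : ℝ)).continuous.comp continuous_clamp
  · have : M.toCircle e ∘ M.edge f = fun _ => 0 := by
      funext s
      exact M.toCircle_of_notMem fun hs => h (M.edge_mem_openEdge_iff.1 hs).1
    rw [this]; exact continuous_const

/-- A contraction of `T` turns `f` into the end of a homotopy starting at a constant map, which
lifts to the universal cover of the circle. -/
lemma exists_lift [ContractibleSpace T] {f : T → AddCircle (1 : ℝ)} (hf : Continuous f) :
    ∃ g : T → ℝ, Continuous g ∧ ∀ x, (g x : AddCircle (1 : ℝ)) = f x := by
  obtain ⟨x₀, ⟨H⟩⟩ := id_nullhomotopic T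
  obtain ⟨r, hr⟩ := QuotientAddGroup.mk_surjective (f x₀)
  have cov := AddCircle.isCoveringMap_coe (1 : ℝ)
  let K : C(unitInterval × T, AddCircle (1 : ℝ)) := (ContinuousMap.mk f hf).comp H.symm.toContinuousMap
  have hK0 : ∀ a, K (0, a) = ((ContinuousMap.const T r) a : ℝ) := fun a => by
    change f (H.symm (0, a)) = _
    rw [H.symm.apply_zero]
    exact hr.symm
  refine ⟨fun x => cov.liftHomotopy K (ContinuousMap.const T r) hK0 (1, x), by fun_prop, fun x => ?_⟩
  have := congrFun (cov.liftHomotopy_lifts K (ContinuousMap.const T r) hK0) (1, x)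
  refine this.trans ?_
  change f (H.symm (1, x)) = _
  rw [H.symm.apply_one]
  rfl

/-- The lift of `toCircle` takes integer values off the open edge, so it is constant on other edges;
on `e` it differs from the parameter by an integer constant. Clamping after normalization makes it
unnecessary to know which integers occur. -/
lemma exists_coord [ContractibleSpace T] (e : E) : ∃ c : T → ℝ,
    (∀ s, c (M.edge e s) = clamp s) ∧ (∀ f, e ≠ f → ∀ s s', c (M.edge f s) = c (M.edge f s')) ∧
    (∀ x, c x ∈ Icc (0 : ℝ) 1) ∧ ∀ x, c x ∈ Ioo (0 : ℝ) 1 → M.edge e (c x) = x := by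
  obtain ⟨g, hg, hgl⟩ := exists_lift (M.continuous_toCircle e)
  have hint : ∀ x ∉ M.openEdge e, ∃ n : ℤ, g x = n := fun x hx => by
    have := hgl x
    rw [M.toCircle_of_notMem hx, AddCircle.coe_eq_zero_iff] at this
    obtain ⟨n, hn⟩ := this
    exact ⟨n, by rw [← hn]; simp⟩
  have hself : ∀ s, g (M.edge e s) - g (M.edge e 0) = clamp s := by
    intro s
    have := eq_of_continuous_of_isInt (h := fun s => g (M.edge e s) - clamp s)
      ((hg.comp (M.continuous_edge e)).sub continuous_clamp) (fun s => by
        have := hgl (M.edge e s)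
        rw [M.toCircle_edge_self, ← sub_eq_zero, ← AddCircle.coe_sub,
          AddCircle.coe_eq_zero_iff] at this
        obtain ⟨n, hn⟩ := this
        exact ⟨n, by rw [← hn]; simp⟩) s 0
    have h0 : clamp 0 = 0 := by simp [clamp]
    simp only [h0] at this
    linarith
  obtain ⟨k, hk⟩ := hint (M.edge e 0) fun h => by
    have := (M.edge_mem_openEdge_iff.1 h).2.1
    exact lt_irrefl _ this
  refine ⟨fun x => clamp (g x - g (M.edge e 0)), fun s => ?_, fun f hf s s' => ?_,
    fun x => clamp_mem _, fun x hx => ?_⟩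
  · simp only [hself, clamp_clamp]
  · have := eq_of_continuous_of_isInt (h := fun s => g (M.edge f s))
      (hg.comp (M.continuous_edge f))
      (fun s => hint _ fun h => hf (M.edge_mem_openEdge_iff.1 h).1.symm) s s'
    exact congrArg (fun z => clamp (z - g (M.edge e 0))) this
  · by_cases hxe : x ∈ M.openEdge e
    · obtain ⟨s, hs, rfl⟩ := hxe
      simp only [hself, clamp_clamp, M.edge_clamp]
    -- Off the open edge the normalized lift is an integer, which cannot lie strictly between `0`
    -- and `1`.
    · obtain ⟨n, hn⟩ := hint x hxe
      have h1 := clamp_mem_Ioo.1 hx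
      rw [hn, hk] at h1
      have h2 : (0 : ℤ) < n - k := by exact_mod_cast h1.1
      have h3 : n - k < (1 : ℤ) := by exact_mod_cast h1.2
      omega

/-- A contractible one-dimensional complex has coordinates. -/
noncomputable def treeCoordinates [ContractibleSpace T] : TreeCoordinates T E where
  edge := M.edge
  coord e := (M.exists_coord e).choose
  edge_clamp := M.edge_clamp
  coord_edge_self e := (M.exists_coord e).choose_spec.1
  coord_edge_of_ne e := (M.exists_coord e).choose_spec.2.1
  coord_mem e := (M.exists_coord e).choose_spec.2.2.1
  edge_coord e := (M.exists_coord e).choose_spec.2.2.2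
  isClosed_iff := M.isClosed_iff

/-! #### Actions on one-dimensional complexes -/

section action

variable {G : Type*} [Group G] [MulAction G T]

/-- The translate of an open edge is connected and avoids the vertices, whose complement is a
disjoint union of open edges. -/
lemma exists_smul_openEdge_subset [ContinuousConstSMul G T] (hV : ∀ (g : G), ∀ x ∈ V, g • x ∈ V)
    (g : G) (e : E) : ∃ e', ∀ x ∈ M.openEdge e, g • x ∈ M.openEdge e' := by
  have hnot : ∀ x ∈ M.openEdge e, g • x ∉ V := by
    rintro _ ⟨s, hs, rfl⟩ h
    have := hV g⁻¹ _ h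
    rw [inv_smul_smul] at this
    exact M.edge_notMem e s hs this
  have hhalf : M.edge e (1 / 2) ∈ M.openEdge e :=
    M.edge_mem_openEdge_iff.2 ⟨rfl, by norm_num, by norm_num⟩
  obtain ⟨e', s', hs', he'⟩ := M.exists_edge _ (hnot _ hhalf)
  have hpre : IsPreconnected ((fun x => g • x) '' M.openEdge e) :=
    (M.isPreconnected_openEdge e).image _ (continuous_const_smul g).continuousOn
  have hsub : (fun x => g • x) '' M.openEdge e ⊆ M.openEdge e' :=
    hpre.subset_left_of_subset_union (v := ⋃ f, ⋃ (_ : f ≠ e'), M.openEdge f)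
      (M.isOpen_openEdge e')
      (isOpen_iUnion fun f => isOpen_iUnion fun _ => M.isOpen_openEdge f)
      (by
        simp only [disjoint_iUnion_right]
        exact fun f hf => disjoint_left.2 fun x hx hx' => hf (M.eq_of_mem_openEdge hx' hx))
      (by
        rintro _ ⟨x, hx, rfl⟩
        obtain ⟨f, s, hs, hfs⟩ := M.exists_edge _ (hnot x hx)
        have hf : g • x ∈ M.openEdge f := ⟨s, hs, hfs⟩
        by_cases h : f = e'
        · exact Or.inl (h ▸ hf)
        · exact Or.inr (mem_iUnion₂.2 ⟨f, h, hf⟩))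
      ⟨_, mem_image_of_mem _ hhalf, ⟨s', hs', he'⟩⟩
  exact ⟨e', fun x hx => hsub (mem_image_of_mem _ hx)⟩

/-- The action on the set of edges. -/
noncomputable abbrev edgeAction [ContinuousConstSMul G T]
    (hV : ∀ (g : G), ∀ x ∈ V, g • x ∈ V) : MulAction G E :=
  have hhalf (e : E) : M.edge e (1 / 2) ∈ M.openEdge e :=
    M.edge_mem_openEdge_iff.2 ⟨rfl, by norm_num, by norm_num⟩
  { smul := fun g e => (M.exists_smul_openEdge_subset hV g e).choose
    one_smul := fun e => M.eq_of_mem_openEdge (x := M.edge e (1 / 2))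
      (by
        have := (M.exists_smul_openEdge_subset hV (1 : G) e).choose_spec _ (hhalf e)
        rwa [one_smul] at this)
      (hhalf e)
    mul_smul := fun g h e => M.eq_of_mem_openEdge (x := (g * h) • M.edge e (1 / 2))
      ((M.exists_smul_openEdge_subset hV (g * h) e).choose_spec _ (hhalf e))
      (by
        rw [mul_smul]
        exact (M.exists_smul_openEdge_subset hV g _).choose_spec _
          ((M.exists_smul_openEdge_subset hV h e).choose_spec _ (hhalf e))) }

/-- The action on the edges is induced by the action on the space. -/
def IsCompatible (M : EdgeMaps T V E) (G : Type*) [Group G] [MulAction G T] [MulAction G E] :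
    Prop :=
  ∀ (g : G) (e : E), ∀ x ∈ M.openEdge e, g • x ∈ M.openEdge (g • e)

lemma isCompatible_edgeAction [ContinuousConstSMul G T]
    (hV : ∀ (g : G), ∀ x ∈ V, g • x ∈ V) :
    letI := M.edgeAction hV
    M.IsCompatible G :=
  fun g e => (M.exists_smul_openEdge_subset hV g e).choose_spec

variable {M} [MulAction G E] (hM : M.IsCompatible G)

/-- An element of `G` that moves the chosen representative of the orbit of `e` to `e`. -/
lemma exists_smul_out_eq (e : E) :
    ∃ g : G, g • (Quotient.mk (MulAction.orbitRel G E) e).out = e := by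
  have : (Quotient.mk (MulAction.orbitRel G E) e).out ∈ MulAction.orbit G e :=
    MulAction.orbitRel_apply.1 (Quotient.mk_out (s := MulAction.orbitRel G E) e)
  obtain ⟨g, hg⟩ := this
  exact ⟨g⁻¹, by rw [← hg, inv_smul_smul]⟩

lemma edge_mem_closure_openEdge (M : EdgeMaps T V E) (e : E) (s : ℝ) :
    M.edge e s ∈ closure (M.openEdge e) := by
  rw [← M.edge_clamp]
  refine image_closure_subset_closure_image (M.continuous_edge e) (mem_image_of_mem _ ?_)
  rw [closure_Ioo zero_ne_one]
  exact clamp_mem s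

include hM in
/-- If stabilizers of edges fix these edges pointwise, then one can parametrize the edges
equivariantly. -/
theorem exists_equivariant [ContinuousConstSMul G T] [T2Space T]
    (hV : ∀ (g : G), ∀ x ∈ V, g • x ∈ V)
    (hfix : ∀ (g : G) (e : E), g • e = e → ∀ x ∈ M.openEdge e, g • x = x) :
    ∃ M' : EdgeMaps T V E, (∀ (g : G) e s, g • M'.edge e s = M'.edge (g • e) s) := by
  -- Each edge takes its parametrization from the representative `r e` of its orbit, transported by
  -- `γ e`.
  choose γ hγ using exists_smul_out_eq (G := G) (E := E)
  set r : E → E := fun e => (Quotient.mk (MulAction.orbitRel G E) e).out with hr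
  have hrg : ∀ (g : G) e, r (g • e) = r e := fun g e => by
    simp only [hr]
    congr 1
    exact Quotient.sound (MulAction.orbitRel_apply.2 (MulAction.mem_orbit e g))
  have hmem : ∀ e, ∀ s ∈ Ioo (0 : ℝ) 1, γ e • M.edge (r e) s ∈ M.openEdge e := fun e s hs => by
    have := hM (γ e) (r e) _ (M.edge_mem_openEdge_iff.2 ⟨rfl, hs⟩)
    rwa [hγ] at this
  have hcont : ∀ e, Continuous fun s => γ e • M.edge (r e) s := fun e =>
    (M.continuous_edge (r e)).const_smul (γ e)
  have hclosed : ∀ (A : Set T) e, IsClosed ((fun s => γ e • M.edge (r e) s) ⁻¹' A) →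
      IsClosed (M.edge e ⁻¹' A) := by
    intro A e hA
    have hcomp : ∀ A : Set T, IsClosed ((fun s => γ e • M.edge (r e) s) ⁻¹' A) →
        IsClosed ((fun s => γ e • M.edge (r e) s) ''
          (Icc 0 1 ∩ (fun s => γ e • M.edge (r e) s) ⁻¹' A)) := fun A hA =>
      ((isCompact_Icc.inter_right hA).image (hcont e)).isClosed
    -- The new edge is compact, hence closed, and contains the old open edge; so it contains the old
    -- closed edge, and the new maps define the same topology.
    have hsub : ∀ s, M.edge e s ∈ (fun s => γ e • M.edge (r e) s) '' Icc 0 1 := fun s => by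
      have hcl : IsClosed ((fun s => γ e • M.edge (r e) s) '' Icc (0 : ℝ) 1) := by
        simpa using hcomp univ (by simp)
      refine hcl.closure_subset_iff.2 ?_ (M.edge_mem_closure_openEdge e s)
      intro x hx
      have h1 := hM (γ e)⁻¹ e x hx
      have h2 : (γ e)⁻¹ • e = r e := by rw [inv_smul_eq_iff, hγ]
      rw [h2] at h1
      obtain ⟨s, hs, hsx⟩ := h1
      exact ⟨s, Ioo_subset_Icc_self hs, by simp [hsx]⟩
    have : M.edge e ⁻¹' A = M.edge e ⁻¹' ((fun s => γ e • M.edge (r e) s) ''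
        (Icc 0 1 ∩ (fun s => γ e • M.edge (r e) s) ⁻¹' A)) := by
      ext s
      simp only [mem_preimage]
      constructor
      · intro h
        obtain ⟨s', hs', h'⟩ := hsub s
        exact ⟨s', ⟨hs', (congrArg (· ∈ A) h').mpr h⟩, h'⟩
      · rintro ⟨s', ⟨-, hs'⟩, h'⟩
        rw [← h']; exact hs'
    rw [this]
    exact (hcomp A hA).preimage (M.continuous_edge e)
  refine ⟨{ edge := fun e s => γ e • M.edge (r e) s
            continuous_edge := hcont
            edge_clamp := fun e s => by rw [M.edge_clamp]
            edge_zero_mem := fun e => hV _ _ (M.edge_zero_mem _)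
            edge_one_mem := fun e => hV _ _ (M.edge_one_mem _)
            edge_notMem := fun e s hs h => by
              have := hV (γ e)⁻¹ _ h
              rw [inv_smul_smul] at this
              exact M.edge_notMem _ s hs this
            edge_injective := fun e e' s hs s' hs' h => by
              have he : e = e' := M.eq_of_mem_openEdge (hmem e s hs) (h ▸ hmem e' s' hs')
              subst he
              exact ⟨rfl, (M.edge_injective _ _ s hs s' hs' (MulAction.injective _ h)).2⟩
            exists_edge := fun x hx => by
              obtain ⟨e, s, hs, hes⟩ := M.exists_edge x hx
              have h1 := hM (γ e)⁻¹ e x ⟨s, hs, hes⟩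
              have h2 : (γ e)⁻¹ • e = r e := by rw [inv_smul_eq_iff, hγ]
              rw [h2] at h1
              obtain ⟨s', hs', hsx⟩ := h1
              exact ⟨e, s', hs', by rw [hsx, smul_inv_smul]⟩
            isClosed_of_edge := fun A hA => M.isClosed_of_edge A fun e => hclosed A e (hA e) },
    fun g e s => ?_⟩
  change g • γ e • M.edge (r e) s = γ (g • e) • M.edge (r (g • e)) s
  rw [hrg, smul_smul, ← inv_smul_eq_iff, smul_smul]
  -- The ambiguity in transport stabilizes `r e`, so it fixes the open edge pointwise and, by
  -- continuity, its closure.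
  have hk : ((γ (g • e))⁻¹ * (g * γ e)) • r e = r e := by
    rw [mul_smul, mul_smul, inv_smul_eq_iff, hγ]
    conv_rhs => rw [← hrg g e]
    exact (hγ (g • e)).symm
  have heq : EqOn (fun x => ((γ (g • e))⁻¹ * (g * γ e)) • x) id (M.openEdge (r e)) :=
    fun x hx => hfix _ _ hk x hx
  exact heq.closure (continuous_const_smul _) continuous_id (M.edge_mem_closure_openEdge _ s)

end action

end EdgeMaps

/-! ### Edges of a CW-tree -/

namespace IsCWTree

open Topology.RelCWComplex in
/-- The edge maps of a CW-complex of dimension at most one. -/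
theorem exists_edgeMaps {T : Type v} [TopologicalSpace T] [T2Space T]
    [Topology.CWComplex (univ : Set T)] (hT : IsCWTree T) :
    ∃ M : EdgeMaps T (skeleton (univ : Set T) 0 : Set T) (cell (univ : Set T) 1),
      ∀ e, M.openEdge e = openCell 1 e := by
  have hdim : ∀ n (e : cell (univ : Set T) n), n = 0 ∨ n = 1 := fun n e => by
    by_contra! h
    exact (hT.isEmpty_cell n (by omega)).false e
  -- Characteristic maps live on the unit ball of `Fin 1 → ℝ`, which is `[-1, 1]`; hence the affine
  -- change of parameter.
  set edge : cell (univ : Set T) 1 → ℝ → T := fun e s => map 1 e fun _ => 2 * clamp s - 1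
    with hedge
  have hnorm : ∀ s : ℝ, ‖(fun _ => s : Fin 1 → ℝ)‖ = |s| := fun s => by
    rw [pi_norm_const, Real.norm_eq_abs]
  have hball : ∀ s : ℝ, (fun _ => 2 * clamp s - 1 : Fin 1 → ℝ) ∈ Metric.closedBall 0 1 := fun s => by
    rw [mem_closedBall_zero_iff, hnorm, abs_le]
    have := clamp_mem s
    constructor <;> linarith [this.1, this.2]
  have hcont : ∀ e, Continuous (edge e) := fun e => by
    refine (continuousOn 1 e).comp_continuous ?_ hball
    have := continuous_clamp
    fun_prop
  have hopen : ∀ e, edge e '' Ioo 0 1 = openCell 1 e := fun e => by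
    ext x
    constructor
    · rintro ⟨s, hs, rfl⟩
      refine mem_image_of_mem _ ?_
      rw [mem_ball_zero_iff, hnorm, abs_lt, clamp_of_mem (Ioo_subset_Icc_self hs)]
      constructor <;> linarith [hs.1, hs.2]
    · rintro ⟨d, hd, rfl⟩
      have hd0 : d = fun _ => d 0 := by
        funext i
        rw [Subsingleton.elim i 0]
      rw [hd0, mem_ball_zero_iff, hnorm, abs_lt] at hd
      refine ⟨(d 0 + 1) / 2, ⟨by linarith [hd.1], by linarith [hd.2]⟩, ?_⟩
      simp only [hedge]
      rw [clamp_of_mem ⟨by linarith [hd.1], by linarith [hd.2]⟩, hd0]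
      congr 1
      funext _
      ring
  have hclosed : ∀ e, closedCell 1 e = edge e '' Icc 0 1 := fun e => by
    ext x
    constructor
    · rintro ⟨d, hd, rfl⟩
      have hd0 : d = fun _ => d 0 := by
        funext i
        rw [Subsingleton.elim i 0]
      rw [hd0, mem_closedBall_zero_iff, hnorm, abs_le] at hd
      refine ⟨(d 0 + 1) / 2, ⟨by linarith [hd.1], by linarith [hd.2]⟩, ?_⟩
      simp only [hedge]
      rw [clamp_of_mem ⟨by linarith [hd.1], by linarith [hd.2]⟩, hd0]
      congr 1
      funext _
      ring
    · rintro ⟨s, -, rfl⟩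
      exact mem_image_of_mem _ (hball s)
  have hfront : ∀ e s, clamp s = 0 ∨ clamp s = 1 →
      edge e s ∈ (skeleton (univ : Set T) 0 : Set T) := fun e s hs => by
    refine cellFrontier_subset_skeleton 0 e (mem_image_of_mem _ ?_)
    rw [mem_sphere_zero_iff_norm, hnorm]
    rcases hs with hs | hs <;> rw [hs] <;> norm_num
  have hdisj : ∀ e, ∀ s ∈ Ioo (0 : ℝ) 1, edge e s ∉ (skeleton (univ : Set T) 0 : Set T) :=
    fun e s hs h => disjoint_left.1 (disjoint_skeleton_openCell (C := univ) (n := 0) (j := e)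
      (by norm_num)) h (hopen e ▸ mem_image_of_mem _ hs)
  refine ⟨{ edge := edge
            continuous_edge := hcont
            edge_clamp := fun e s => by simp only [hedge, clamp_clamp]
            edge_zero_mem := fun e => hfront e 0 (Or.inl (by simp [clamp]))
            edge_one_mem := fun e => hfront e 1 (Or.inr (by simp [clamp]))
            edge_notMem := hdisj
            edge_injective := fun e e' s hs s' hs' h => by
              have h1 : edge e s ∈ openCell 1 e := hopen e ▸ mem_image_of_mem _ hs
              have h2 : edge e s ∈ openCell 1 e' := h ▸ hopen e' ▸ mem_image_of_mem _ hs'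
              have he : e = e' := by
                by_contra hne
                refine disjoint_left.1 (disjoint_openCell_of_ne (C := univ) (i := e) (j := e')
                  fun h => hne ?_) h1 h2
                simpa using h
              subst he
              refine ⟨rfl, ?_⟩
              have hsrc : ∀ s ∈ Ioo (0 : ℝ) 1,
                  (fun _ => 2 * clamp s - 1 : Fin 1 → ℝ) ∈ (map 1 e).source := fun s hs => by
                rw [source_eq, mem_ball_zero_iff, hnorm, abs_lt,
                  clamp_of_mem (Ioo_subset_Icc_self hs)]
                constructor <;> linarith [hs.1, hs.2]
              have := congrFun ((map 1 e).injOn (hsrc s hs) (hsrc s' hs') h) 0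
              simp only [clamp_of_mem (Ioo_subset_Icc_self hs),
                clamp_of_mem (Ioo_subset_Icc_self hs')] at this
              linarith
            exists_edge := fun x hx => by
              have hx' : x ∈ ⋃ (n : ℕ) (j : cell (univ : Set T) n), openCell n j := by
                rw [Topology.CWComplex.iUnion_openCell_eq_complex]; trivial
              simp only [mem_iUnion] at hx'
              obtain ⟨n, e, he⟩ := hx'
              rcases hdim n e with rfl | rfl
              · exact absurd (openCell_subset_skeleton 0 e he) hx
              · rw [← hopen e] at he
                exact ⟨e, he⟩
            isClosed_of_edge := fun A hA => by
              refine (Topology.CWComplex.closed (univ : Set T) A (subset_univ _)).2 fun n e => ?_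
              rcases hdim n e with rfl | rfl
              · refine Set.Finite.isClosed (Finite.subset (finite_singleton (map 0 e ![])) ?_)
                refine inter_subset_right.trans ?_
                exact (closedCell_zero_eq_singleton (C := univ) (j := e)).le
              · rw [hclosed, inter_comm, ← image_inter_preimage]
                exact ((isCompact_Icc.inter_right (hA e)).image (hcont e)).isClosed },
    hopen⟩

end IsCWTree

/-! ### Equivariant cell structures -/

/-- A criterion for the attachment of equivariant cells with open stabilizers, in terms of
characteristic maps `D^n → X` of representatives of the orbits of cells. -/
lemma attachesEquivariantCells_of_representatives {G : Type u} {X : Type v} [Group G]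
    [TopologicalSpace G] [IsTopologicalGroup G] [TopologicalSpace X] [MulAction G X]
    [ContinuousSMul G X] {n : ℕ} {A B : Set X} (hAB : A ⊆ B)
    (hA : ∀ (g : G), ∀ x ∈ A, g • x ∈ A) (hB : ∀ (g : G), ∀ x ∈ B, g • x ∈ B)
    {ι : Type v} (H : ι → Subgroup G) (hH : ∀ i, IsOpen (H i : Set G))
    (f : ι → Disk n → X) (hf : ∀ i, Continuous (f i)) (hfH : ∀ i, ∀ h ∈ H i, ∀ d, h • f i d = f i d)
    (hbd : ∀ i d, ‖d.1‖ = 1 → f i d ∈ A) (hint : ∀ i d, ‖d.1‖ < 1 → f i d ∈ B \ A)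
    (hinj : ∀ i j d d' (g : G), ‖d.1‖ < 1 → ‖d'.1‖ < 1 → g • f i d = f j d' →
      i = j ∧ d = d' ∧ g ∈ H i)
    (hsurj : ∀ x ∈ B \ A, ∃ i d, ∃ g : G, ‖d.1‖ < 1 ∧ g • f i d = x)
    (hcl : ∀ K : Set X, IsClosed ((↑) ⁻¹' K : Set A) → (∀ i (g : G), IsClosed {d | g • f i d ∈ K}) →
      IsClosed ((↑) ⁻¹' K : Set B)) :
    AttachesEquivariantCells G n A B := by
  have hψ := fun i => exists_quotient_prod_map (hf i) (hfH i)
  choose ψ hψc hψg using hψ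
  have hAinv : ∀ (g : G) x, g • x ∈ A → x ∈ A := fun g x h => by
    simpa using hA g⁻¹ _ h
  have hmem : ∀ i c d, ψ i (c, d) ∈ B := fun i c d => by
    induction c using QuotientGroup.induction_on with
    | H g =>
      rw [hψg]
      rcases (mem_closedBall_zero_iff.1 d.2).lt_or_eq with hd | hd
      · exact hB g _ (hint i d hd).1
      · exact hB g _ (hAB (hbd i d hd))
  refine ⟨ι, H, ψ, fun i => (H i).isClosed_of_isOpen (hH i), hψc, fun i g c d => ?_,
    fun i c d hd => ?_, ⟨?_, ?_, ?_⟩, fun K => ⟨fun hK => ⟨?_, fun i => ?_⟩, fun hK => ?_⟩⟩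
  · induction c using QuotientGroup.induction_on with
    | H c => rw [MulAction.Quotient.smul_coe, hψg, hψg, smul_eq_mul, mul_smul]
  · induction c using QuotientGroup.induction_on with
    | H g =>
      rw [hψg]
      exact hA g _ (hbd i d hd)
  · rintro ⟨i, c, d⟩ hd
    induction c using QuotientGroup.induction_on with
    | H g =>
      simp only [hψg]
      exact ⟨hB g _ (hint i d hd).1, fun h => (hint i d hd).2 (hAinv g _ h)⟩
  · rintro ⟨i, c, d⟩ hd ⟨j, c', d'⟩ hd' h
    induction c using QuotientGroup.induction_on with
    | H g =>
      induction c' using QuotientGroup.induction_on with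
      | H g' =>
        simp only [hψg] at h
        have h' : (g'⁻¹ * g) • f i d = f j d' := by rw [mul_smul, h, inv_smul_smul]
        obtain ⟨rfl, rfl, hg⟩ := hinj i j d d' _ hd hd' h'
        have : (g : G ⧸ H i) = g' := (QuotientGroup.eq.2 hg).symm
        rw [this]
  · intro x hx
    obtain ⟨i, d, g, hd, h⟩ := hsurj x hx
    exact ⟨⟨i, (g : G ⧸ H i), d⟩, hd, by simp only [hψg, h]⟩
  · exact hK.preimage (continuous_inclusion hAB)
  · exact hK.preimage (f := fun p => (⟨ψ i p, hmem i p.1 p.2⟩ : B)) ((hψc i).subtype_mk _)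
  · refine hcl K hK.1 fun i g => ?_
    have : Continuous fun d : Disk n => ((g : G ⧸ H i), d) := by fun_prop
    convert (hK.2 i).preimage this using 1
    ext d
    simp [hψg]

namespace EdgeMaps

variable {T : Type v} {E : Type v} [TopologicalSpace T] {V : Set T} {M : EdgeMaps T V E}

/-- Vertices occur on an edge only at its ends. Applied to all subsets of `V`, this says that `V` is
closed and discrete. -/
lemma isClosed_of_subset_vertices [T2Space T] (M : EdgeMaps T V E) {A : Set T} (hA : A ⊆ V) :
    IsClosed A := by
  refine (M.isClosed_iff A).2 fun e => ?_
  have : M.edge e ⁻¹' A = clamp ⁻¹' ({0, 1} ∩ M.edge e ⁻¹' A) := by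
    ext s
    simp only [mem_preimage, mem_inter_iff, M.edge_clamp]
    refine ⟨fun h => ⟨?_, h⟩, fun h => h.2⟩
    exact clamp_eq_of_notMem_Ioo fun hs => M.edge_notMem e s hs (hA h)
  rw [this]
  exact (((finite_singleton (1 : ℝ)).insert 0).inter_of_left _).isClosed.preimage continuous_clamp

section action

variable {G : Type u} [Group G] [TopologicalSpace G] [IsTopologicalGroup G] [MulAction G T]
  [ContinuousSMul G T] [MulAction G E] (hM : ∀ (g : G) e s, g • M.edge e s = M.edge (g • e) s)

include hM

omit [TopologicalSpace G] [IsTopologicalGroup G] [ContinuousSMul G T] in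
lemma smul_eq_of_edge {g : G} {e e' : E} {s s' : ℝ} (hs : s ∈ Ioo (0 : ℝ) 1)
    (hs' : s' ∈ Ioo (0 : ℝ) 1) (h : g • M.edge e s = M.edge e' s') : g • e = e' ∧ s = s' := by
  rw [hM] at h
  exact M.edge_injective _ _ _ hs _ hs' h

omit [IsTopologicalGroup G] in
-- An element stabilizes `e` exactly when it keeps the midpoint in the open edge, which is an open
-- condition.
lemma isOpen_edge_stabilizer (e : E) : IsOpen (MulAction.stabilizer G e : Set G) := by
  have : (MulAction.stabilizer G e : Set G) = (fun g => g • M.edge e (1 / 2)) ⁻¹' M.openEdge e := by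
    ext g
    rw [mem_preimage, hM, M.edge_mem_openEdge_iff]
    simp only [SetLike.mem_coe, MulAction.mem_stabilizer_iff, iff_self_and]
    norm_num
  rw [this]
  exact (M.isOpen_openEdge e).preimage (by fun_prop)

omit hM [IsTopologicalGroup G] [MulAction G E] in
lemma isOpen_vertex_stabilizer [T2Space T] (M : EdgeMaps T V E)
    (hV : ∀ (g : G), ∀ x ∈ V, g • x ∈ V) {x : T} (hx : x ∈ V) :
    IsOpen (MulAction.stabilizer G x : Set G) := by
  have : (MulAction.stabilizer G x : Set G) = ((fun g : G => g • x) ⁻¹' (V \ {x}))ᶜ := by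
    ext g
    simp [hV g x hx]
  rw [this, isOpen_compl_iff]
  exact (M.isClosed_of_subset_vertices sdiff_subset).preimage (by fun_prop)

lemma isOpen_stabilizer [T2Space T] (hV : ∀ (g : G), ∀ x ∈ V, g • x ∈ V) (x : T) :
    IsOpen (MulAction.stabilizer G x : Set G) := by
  by_cases hx : x ∈ V
  · exact M.isOpen_vertex_stabilizer hV hx
  · obtain ⟨e, s, hs, rfl⟩ := M.exists_edge x hx
    refine Subgroup.isOpen_mono (H₁ := MulAction.stabilizer G e) (fun g hg => ?_)
      (isOpen_edge_stabilizer hM e)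
    rw [MulAction.mem_stabilizer_iff] at hg ⊢
    rw [hM, hg]

omit hM in
lemma norm_disk_one (d : EuclideanSpace ℝ (Fin 1)) : ‖d‖ = |d 0| := by
  simp [EuclideanSpace.norm_eq, Real.sqrt_sq_eq_abs]

omit hM [MulAction G E] in
lemma attachesEquivariantCells_zero [T2Space T] (M : EdgeMaps T V E)
    (hV : ∀ (g : G), ∀ x ∈ V, g • x ∈ V) : AttachesEquivariantCells G 0 ∅ V := by
  have hout : ∀ x : T, ∃ g : G, g • (Quotient.mk (MulAction.orbitRel G T) x).out = x := fun x => by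
    obtain ⟨g, hg⟩ := MulAction.orbitRel_apply.1 (Quotient.mk_out (s := MulAction.orbitRel G T) x)
    exact ⟨g⁻¹, by rw [← hg, inv_smul_smul]⟩
  refine attachesEquivariantCells_of_representatives (empty_subset _) (fun _ _ h => h.elim) hV
    (ι := {q : MulAction.orbitRel.Quotient G T // q.out ∈ V})
    (fun q => MulAction.stabilizer G q.1.out) (fun q => M.isOpen_vertex_stabilizer hV q.2)
    (fun q _ => q.1.out) (fun _ => continuous_const) (fun q h hh _ => hh) (fun q d hd => ?_)
    (fun q d hd => ⟨q.2, notMem_empty _⟩) (fun q q' d d' g _ _ h => ?_) (fun x hx => ?_)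
    (fun K _ _ => ?_)
  -- The disk `D^0` has empty boundary.
  · rw [Subsingleton.elim d.1 0, norm_zero] at hd
    exact absurd hd zero_ne_one
  · have hq : q.1 = q'.1 := by
      rw [← Quotient.out_eq q.1, ← Quotient.out_eq q'.1]
      exact (Quotient.sound (MulAction.orbitRel_apply.2 ⟨g, h⟩)).symm
    obtain rfl := Subtype.ext hq
    exact ⟨rfl, Subsingleton.elim _ _, h⟩
  · obtain ⟨g, hg⟩ := hout x
    refine ⟨⟨Quotient.mk (MulAction.orbitRel G T) x, ?_⟩, ⟨0, by simp⟩, g, by simp, hg⟩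
    have := hV g⁻¹ x hx.1
    rwa [← hg, inv_smul_smul] at this
  · rw [← Subtype.preimage_coe_inter_self]
    exact (M.isClosed_of_subset_vertices inter_subset_right).preimage continuous_subtype_val

lemma attachesEquivariantCells_one (hV : ∀ (g : G), ∀ x ∈ V, g • x ∈ V) :
    AttachesEquivariantCells G 1 V univ := by
  have hhalf : ∀ d : Disk 1, ‖d.1‖ < 1 → (1 + d.1 0) / 2 ∈ Ioo (0 : ℝ) 1 := fun d hd => by
    rw [norm_disk_one, abs_lt] at hd
    exact ⟨by linarith [hd.1], by linarith [hd.2]⟩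
  have hinv : ∀ s : ℝ, ∃ d : Disk 1, (1 + d.1 0) / 2 = clamp s := fun s => by
    refine ⟨⟨WithLp.toLp 2 fun _ => 2 * clamp s - 1, ?_⟩, by simp⟩
    rw [mem_closedBall_zero_iff, norm_disk_one, abs_le]
    have := clamp_mem s
    constructor <;> simp only <;> linarith [this.1, this.2]
  refine attachesEquivariantCells_of_representatives (subset_univ _) hV (fun _ _ _ => trivial)
    (ι := MulAction.orbitRel.Quotient G E)
    (fun q => MulAction.stabilizer G q.out) (fun q => isOpen_edge_stabilizer hM _)
    (fun q d => M.edge q.out ((1 + d.1 0) / 2))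
    (fun q => (M.continuous_edge _).comp (by fun_prop)) (fun q h hh d => ?_) (fun q d hd => ?_)
    (fun q d hd => ⟨trivial, M.edge_notMem _ _ (hhalf d hd)⟩) (fun q q' d d' g hd hd' h => ?_)
    (fun x hx => ?_) (fun K _ hK => ?_)
  · rw [MulAction.mem_stabilizer_iff] at hh
    rw [hM, hh]
  · refine M.edge_mem_of_notMem_Ioo _ fun h => ?_
    rw [norm_disk_one] at hd
    have : |d.1 0| < 1 := abs_lt.2 ⟨by linarith [h.1], by linarith [h.2]⟩
    linarith
  · obtain ⟨h1, h2⟩ := smul_eq_of_edge hM (hhalf d hd) (hhalf d' hd') h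
    have hq : q = q' := by
      rw [← Quotient.out_eq q, ← Quotient.out_eq q']
      exact (Quotient.sound (MulAction.orbitRel_apply.2 ⟨g, h1⟩)).symm
    subst hq
    refine ⟨rfl, Subtype.ext (PiLp.ext fun i => ?_), h1⟩
    rw [Subsingleton.elim i 0]
    linarith
  · obtain ⟨e, s, hs, rfl⟩ := M.exists_edge x hx.2
    obtain ⟨g, hg⟩ := exists_smul_out_eq (G := G) e
    obtain ⟨d, hd⟩ := hinv s
    rw [clamp_of_mem (Ioo_subset_Icc_self hs)] at hd
    refine ⟨Quotient.mk (MulAction.orbitRel G E) e, d, g, ?_, ?_⟩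
    · rw [norm_disk_one, abs_lt]
      constructor <;> linarith [hs.1, hs.2]
    · rw [hM, hg, hd]
  · refine IsClosed.preimage continuous_subtype_val ((M.isClosed_iff K).2 fun e => ?_)
    obtain ⟨g, hg⟩ := exists_smul_out_eq (G := G) e
    have h1 := hK (Quotient.mk (MulAction.orbitRel G E) e) g
    have hd : Continuous fun s : ℝ => (⟨WithLp.toLp 2 fun _ => 2 * clamp s - 1, by
        rw [mem_closedBall_zero_iff, norm_disk_one, abs_le]
        have := clamp_mem s
        constructor <;> simp only <;> linarith [this.1, this.2]⟩ : Disk 1) := by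
      have := continuous_clamp
      fun_prop
    convert h1.preimage hd using 1
    ext s
    simp only [mem_preimage, mem_ofPred_eq]
    rw [hM, hg, ← M.edge_clamp e s]
    congr! 2
    ring

theorem exists_gcwStructure [T2Space T] (hV : ∀ (g : G), ∀ x ∈ V, g • x ∈ V) {skel : ℕ → Set T}
    (h0 : skel 0 = V) (h1 : ∀ n, skel (n + 1) = univ) :
    ∃ S : GCWStructure G T, S.skel = skel := by
  refine ⟨{ skel := skel
            mono := monotone_nat_of_le_succ fun n => by rw [h1]; exact subset_univ _
            smul_mem := fun n g x hx => ?_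
            iUnion_skel := eq_univ_of_forall fun x => mem_iUnion.2 ⟨1, by rw [h1]; trivial⟩
            isClosed_iff := fun K => ⟨fun hK n => hK.preimage continuous_subtype_val, fun hK => ?_⟩
            attach_zero := h0 ▸ M.attachesEquivariantCells_zero hV
            attach_succ := fun n => ?_ }, rfl⟩
  · cases n with
    | zero => rw [h0] at hx ⊢; exact hV g x hx
    | succ n => rw [h1]; trivial
  · have h2 := hK 1
    have hu : ∀ x : T, x ∈ skel 1 := fun x => by rw [h1]; trivial
    exact h2.preimage (f := fun x => (⟨x, hu x⟩ : skel 1)) (by fun_prop)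
  · rw [h1]
    cases n with
    | zero => rw [h0]; exact attachesEquivariantCells_one hM hV
    | succ n =>
      rw [h1]
      exact attachesEquivariantCells_of_representatives (subset_univ _) (fun _ _ _ => trivial)
        (fun _ _ _ => trivial) (ι := PEmpty) (fun i => i.elim) (fun i => i.elim) (fun i => i.elim)
        (fun i => i.elim) (fun i => i.elim) (fun i => i.elim) (fun i => i.elim) (fun i => i.elim)
        (fun x hx => absurd hx.1 hx.2) (fun K hK _ => hK)

end action

end EdgeMaps

/-! ### The kernel of the action -/

/-- If the stabilizers are compact and open, then the kernel of the action is compact, contains the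
identity component, and has a totally disconnected quotient. -/
theorem exists_compact_normal_subgroup {G T : Type*} [Group G] [TopologicalSpace G]
    [IsTopologicalGroup G] [T2Space G] [TopologicalSpace T] [T2Space T] [MulAction G T]
    [ContinuousSMul G T] [Nonempty T] (hc : ∀ x : T, IsCompact (MulAction.stabilizer G x : Set G))
    (ho : ∀ x : T, IsOpen (MulAction.stabilizer G x : Set G)) :
    ∃ (K : Subgroup G) (_ : K.Normal), IsCompact (K : Set G) ∧
      Subgroup.connectedComponentOfOne G ≤ K ∧ TotallyDisconnectedSpace (G ⧸ K) ∧
      ∀ k ∈ K, ∀ x : T, k • x = x := by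
  have hK : ∀ k, k ∈ (MulAction.toPermHom G T).ker ↔ ∀ x : T, k • x = x := fun k => by
    rw [MonoidHom.mem_ker, Equiv.ext_iff]
    rfl
  have hset : ((MulAction.toPermHom G T).ker : Set G) =
      ⋂ x : T, (MulAction.stabilizer G x : Set G) := by
    ext k
    simp [hK]
  refine ⟨(MulAction.toPermHom G T).ker, inferInstance, ?_, ?_, ?_, fun k hk => (hK k).1 hk⟩
  · obtain ⟨x⟩ := ‹Nonempty T›
    refine (hc x).of_isClosed_subset ?_ (hset ▸ iInter_subset _ x)
    rw [hset]
    exact isClosed_iInter fun x => (hc x).isClosed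
  · intro k hk
    rw [hK]
    intro x
    have hcl : IsClopen (MulAction.stabilizer G x : Set G) := ⟨(hc x).isClosed, ho x⟩
    -- A clopen subgroup contains the identity component.
    exact isPreconnected_connectedComponent.subset_isClopen hcl
      ⟨1, mem_connectedComponent, (MulAction.stabilizer G x).one_mem⟩ hk
  · suffices TotallySeparatedSpace (G ⧸ (MulAction.toPermHom G T).ker) from inferInstance
    refine totallySeparatedSpace_iff_exists_isClopen.2 fun a b hab => ?_
    induction a using QuotientGroup.induction_on with
    | H a =>
      induction b using QuotientGroup.induction_on with
      | H b =>
        have : a⁻¹ * b ∉ (MulAction.toPermHom G T).ker := fun h => hab (QuotientGroup.eq.2 h)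
        rw [hK] at this
        push Not at this
        obtain ⟨x, hx⟩ := this
        obtain ⟨ψ, hψ, hψg⟩ := exists_quotient_map (H := (MulAction.toPermHom G T).ker) (m := x)
          fun h hh => (hK h).1 hh x
        -- The orbit map of a point `x` that `a⁻¹ * b` moves separates the two cosets. Its fibre is
        -- open because it pulls back to a translate of the open stabilizer.
        refine ⟨ψ ⁻¹' {a • x}, ⟨isClosed_singleton.preimage hψ, ?_⟩, by simp [hψg], ?_⟩
        · rw [← (QuotientGroup.isQuotientMap_mk _).isOpen_preimage]
          have : QuotientGroup.mk ⁻¹' (ψ ⁻¹' {a • x}) =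
              (fun g : G => a⁻¹ * g) ⁻¹' (MulAction.stabilizer G x : Set G) := by
            ext g
            simp [hψg, mul_smul, inv_smul_eq_iff]
          rw [this]
          exact (ho x).preimage (by fun_prop)
        · intro h
          refine hx ?_
          rw [mul_smul, inv_smul_eq_iff, ← hψg b]
          exact h

/-! ### Numerability of trees -/

lemma finsum_sumElim {α β : Type*} {f : α → ℝ} {g : β → ℝ} (hf : (support f).Finite)
    (hg : (support g).Finite) : ∑ᶠ i, Sum.elim f g i = ∑ᶠ a, f a + ∑ᶠ b, g b := by
  rw [finsum_eq_sum_of_support_subset (s := hf.toFinset) f (by simp),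
    finsum_eq_sum_of_support_subset (s := hg.toFinset) g (by simp),
    finsum_eq_sum_of_support_subset (s := hf.toFinset.disjSum hg.toFinset), Finset.sum_disjSum]
  · simp
  · rintro (i | i) hi <;> simpa using hi

/-! ### Splitting a function along a disjoint open cover of its closed support -/

section split

variable {X ι : Type*} [TopologicalSpace X] {U : ι → Set X} {ρ : X → ℝ}

/-- Since the closed support is covered, cutting `ρ` off at some `U i` creates no jump: near each
point `ρ` vanishes or belongs to a single piece. -/
lemma eventually_indicator_eq (hU : ∀ i, IsOpen (U i)) (hd : Pairwise (Disjoint on U))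
    (hs : tsupport ρ ⊆ ⋃ i, U i) (x : X) :
    (ρ =ᶠ[𝓝 x] 0) ∨ ∃ i, x ∈ U i ∧ (U i).indicator ρ =ᶠ[𝓝 x] ρ ∧
      ∀ᶠ y in 𝓝 x, ∀ j ≠ i, (U j).indicator ρ y = 0 := by
  by_cases hx : x ∈ tsupport ρ
  · obtain ⟨i, hi⟩ := mem_iUnion.1 (hs hx)
    refine Or.inr ⟨i, hi, ?_, ?_⟩
    · filter_upwards [(hU i).mem_nhds hi] with y hy using indicator_of_mem hy _
    · filter_upwards [(hU i).mem_nhds hi] with y hy j hj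
      exact indicator_of_notMem (disjoint_left.1 (hd hj.symm) hy) _
  · exact Or.inl (notMem_tsupport_iff_eventuallyEq.1 hx)

lemma continuous_indicator_of_disjoint (hU : ∀ i, IsOpen (U i)) (hd : Pairwise (Disjoint on U))
    (hs : tsupport ρ ⊆ ⋃ i, U i) (hρ : Continuous ρ) (i : ι) :
    Continuous ((U i).indicator ρ) := by
  refine continuous_iff_continuousAt.2 fun x => ?_
  rcases eventually_indicator_eq hU hd hs x with h | ⟨j, -, h1, h2⟩
  · refine (continuousAt_const (y := (0 : ℝ))).congr ?_
    filter_upwards [h] with y hy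
    by_cases hi : y ∈ U i
    · rw [indicator_of_mem hi, hy]; rfl
    · rw [indicator_of_notMem hi]
  · by_cases hij : i = j
    · subst hij
      exact hρ.continuousAt.congr h1.symm
    · refine (continuousAt_const (y := (0 : ℝ))).congr ?_
      filter_upwards [h2] with y hy
      exact (hy i hij).symm

lemma tsupport_indicator_subset (hU : ∀ i, IsOpen (U i)) (hd : Pairwise (Disjoint on U))
    (hs : tsupport ρ ⊆ ⋃ i, U i) (i : ι) : tsupport ((U i).indicator ρ) ⊆ U i := by
  intro x hx
  obtain ⟨j, hj⟩ := mem_iUnion.1 (hs (closure_mono (support_indicator.trans_subset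
    inter_subset_right) hx))
  by_cases hij : i = j
  · exact hij ▸ hj
  · refine absurd hx (notMem_tsupport_iff_eventuallyEq.2 ?_)
    filter_upwards [(hU j).mem_nhds hj] with y hy
    exact indicator_of_notMem (disjoint_right.1 (hd hij) hy) _

lemma locallyFinite_indicator (hU : ∀ i, IsOpen (U i)) (hd : Pairwise (Disjoint on U))
    (hs : tsupport ρ ⊆ ⋃ i, U i) : LocallyFinite fun i => support ((U i).indicator ρ) := by
  intro x
  rcases eventually_indicator_eq hU hd hs x with h | ⟨j, -, -, h2⟩
  · refine ⟨_, h, ?_⟩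
    convert finite_empty (α := ι)
    refine eq_empty_of_forall_notMem fun i => ?_
    rintro ⟨y, hy1, hy2⟩
    have hy2' : ρ y = (0 : X → ℝ) y := hy2
    have hy1' : y ∈ support ((U i).indicator ρ) := hy1
    rw [support_indicator] at hy1'
    exact hy1'.2 hy2'
  · refine ⟨_, h2, (finite_singleton j).subset ?_⟩
    rintro i ⟨y, hy1, hy2⟩
    by_contra hij
    exact hy1 (hy2 i hij)

lemma finsum_indicator (hd : Pairwise (Disjoint on U)) (hs : tsupport ρ ⊆ ⋃ i, U i) (x : X) :
    ∑ᶠ i, (U i).indicator ρ x = ρ x := by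
  by_cases hx : ρ x = 0
  · rw [hx]
    refine finsum_eq_zero_of_forall_eq_zero fun i => ?_
    by_cases hi : x ∈ U i
    · rw [indicator_of_mem hi, hx]
    · rw [indicator_of_notMem hi]
  · obtain ⟨i, hi⟩ := mem_iUnion.1 (hs (subset_tsupport ρ hx))
    rw [finsum_eq_single _ i, indicator_of_mem hi]
    intro j hj
    exact indicator_of_notMem (disjoint_left.1 (hd hj.symm) hi) _

end split

/-- A bump function on the unit interval. -/
noncomputable def bump (s : ℝ) : ℝ := clamp (2 - |6 * s - 3|)

lemma continuous_bump : Continuous bump := by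
  have := continuous_clamp
  unfold bump
  fun_prop

/-- The plateau around the midpoint and the zero sets near the ends keep the closed supports of the
bump and of its complement away from vertices and midpoints respectively. -/
lemma bump_eq_one {s : ℝ} (h : |s - 1 / 2| ≤ 1 / 6) : bump s = 1 := by
  have : |6 * s - 3| ≤ 1 := by
    rw [abs_le] at *
    constructor <;> linarith [h.1, h.2]
  unfold bump clamp
  rw [min_eq_left (by linarith), max_eq_right zero_le_one]

lemma bump_eq_zero {s : ℝ} (h : s ≤ 1 / 6 ∨ 5 / 6 ≤ s) : bump s = 0 := by
  have : 2 ≤ |6 * s - 3| := by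
    rw [le_abs]
    rcases h with h | h
    · right; linarith
    · left; linarith
  unfold bump clamp
  rw [max_eq_left]
  exact (min_le_right _ _).trans (by linarith)

lemma bump_of_notMem_Ioo {s : ℝ} (h : s ∉ Ioo (0 : ℝ) 1) : bump s = 0 := by
  apply bump_eq_zero
  by_contra! hc
  exact h ⟨by linarith [hc.1], by linarith [hc.2]⟩

namespace TreeCoordinates

variable {T E : Type*} [TopologicalSpace T] (C : TreeCoordinates T E)

/-- The open ball of radius `1 / 2` in each coordinate. -/
def halfBox (p : T) : Set T := C.box p fun _ => 1 / 2

lemma isOpen_halfBox (p : T) : IsOpen (C.halfBox p) := C.isOpen_box _ _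

lemma mem_halfBox_self (p : T) : p ∈ C.halfBox p := C.mem_box_self fun _ => by norm_num

lemma edge_mem_halfBox {e : E} {s s' : ℝ} (h : |clamp s - clamp s'| < 1 / 2) :
    C.edge e s ∈ C.halfBox (C.edge e s') := fun f => by
  by_cases hf : f = e
  · subst hf
    rwa [C.coord_edge_self, C.coord_edge_self]
  · rw [C.coord_edge_of_ne f e hf s s']
    norm_num

/-! ### Invariant neighbourhoods of orbits and their maps to homogeneous spaces -/

section action

variable {C} {G : Type*} [Group G] [MulAction G T] [MulAction G E] [PreconnectedSpace T]
  (hG : C.IsEquivariant G)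

include hG

lemma smul_mem_halfBox {p x : T} (g : G) (h : x ∈ C.halfBox p) : g • x ∈ C.halfBox (g • p) :=
  fun e => by
    have := h (g⁻¹ • e)
    rwa [← coord_smul hG g _ x, ← coord_smul hG g _ p, smul_inv_smul] at this

variable (C) (G) in
omit hG [PreconnectedSpace T] [MulAction G E] in
/-- The points close to those points of `S` that belong to the orbit `q`. -/
def orbitBox (S : Set T) (q : MulAction.orbitRel.Quotient G T) : Set T :=
  ⋃ p, ⋃ (_ : p ∈ S ∧ Quotient.mk _ p = q), C.halfBox p

omit hG [PreconnectedSpace T] [MulAction G E] in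
lemma mem_orbitBox {S : Set T} {q : MulAction.orbitRel.Quotient G T} {x : T} :
    x ∈ C.orbitBox G S q ↔ ∃ p ∈ S, Quotient.mk _ p = q ∧ x ∈ C.halfBox p := by
  simp only [orbitBox, mem_iUnion, exists_prop, and_assoc]

omit hG [PreconnectedSpace T] [MulAction G E] in
lemma isOpen_orbitBox (S : Set T) (q : MulAction.orbitRel.Quotient G T) :
    IsOpen (C.orbitBox G S q) :=
  isOpen_iUnion fun p => isOpen_iUnion fun _ => C.isOpen_halfBox p

omit hG [PreconnectedSpace T] [MulAction G E] in
lemma disjoint_orbitBox {S : Set T}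
    (hd : ∀ p ∈ S, ∀ q ∈ S, ∀ x, x ∈ C.halfBox p → x ∈ C.halfBox q → p = q) :
    Pairwise (Disjoint on C.orbitBox G S) := by
  intro q q' hq
  refine disjoint_left.2 fun x hx hx' => hq ?_
  obtain ⟨p, hp, rfl, hpx⟩ := mem_orbitBox.1 hx
  obtain ⟨p', hp', rfl, hpx'⟩ := mem_orbitBox.1 hx'
  rw [hd p hp p' hp' x hpx hpx']

omit hG [PreconnectedSpace T] [MulAction G E] in
lemma iUnion_orbitBox (S : Set T) : ⋃ q, C.orbitBox G S q = ⋃ p ∈ S, C.halfBox p := by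
  ext x
  simp only [mem_iUnion, mem_orbitBox]
  constructor
  · rintro ⟨q, p, hp, -, hx⟩
    exact ⟨p, hp, hx⟩
  · rintro ⟨p, hp, hx⟩
    exact ⟨_, p, hp, rfl, hx⟩

lemma smul_mem_orbitBox {S : Set T} (hS : ∀ (g : G), ∀ p ∈ S, g • p ∈ S) (g : G)
    (q : MulAction.orbitRel.Quotient G T) {x : T} (hx : x ∈ C.orbitBox G S q) :
    g • x ∈ C.orbitBox G S q := by
  obtain ⟨p, hp, rfl, hpx⟩ := mem_orbitBox.1 hx
  exact mem_orbitBox.2 ⟨g • p, hS g p hp,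
    Quotient.sound (MulAction.orbitRel_apply.2 (MulAction.mem_orbit p g)),
    smul_mem_halfBox hG g hpx⟩

/-- The boxes around the points of an orbit are open and disjoint, so sending the box around `g • p`
to the coset of `g` is well defined and locally constant. -/
lemma exists_orbitBox_map [TopologicalSpace G] [Nonempty T] (F : SubgroupFamily G)
    (hF : ∀ x : T, MulAction.stabilizer G x ∈ F.carrier) {S : Set T}
    (hd : ∀ p ∈ S, ∀ q ∈ S, ∀ x, x ∈ C.halfBox p → x ∈ C.halfBox q → p = q)
    (hS : ∀ (g : G), ∀ p ∈ S, g • p ∈ S) (q : MulAction.orbitRel.Quotient G T) :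
    ∃ H ∈ F.carrier, ∃ φ : C.orbitBox G S q → G ⧸ H, Continuous φ ∧
      ∀ (g : G) (x y : C.orbitBox G S q), (y : T) = g • (x : T) → φ y = g • φ x := by
  by_cases hq : ∃ p ∈ S, Quotient.mk _ p = q
  · obtain ⟨p, hp, rfl⟩ := hq
    have hex : ∀ x : C.orbitBox G S (Quotient.mk _ p), ∃ g : G, (x : T) ∈ C.halfBox (g • p) := by
      rintro ⟨x, hx⟩
      obtain ⟨p', -, hpp', hx⟩ := mem_orbitBox.1 hx
      obtain ⟨g, rfl⟩ := MulAction.orbitRel_apply.1 (Quotient.exact hpp')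
      exact ⟨g, hx⟩
    choose γ hγ using hex
    have huniq : ∀ (x : C.orbitBox G S (Quotient.mk _ p)) (g : G), (x : T) ∈ C.halfBox (g • p) →
        (γ x : G ⧸ MulAction.stabilizer G p) = g := fun x g hx => by
      have := hd _ (hS (γ x) p hp) _ (hS g p hp) x (hγ x) hx
      rw [QuotientGroup.eq, MulAction.mem_stabilizer_iff, mul_smul, inv_smul_eq_iff]
      exact this.symm
    refine ⟨_, hF p, fun x => γ x, ?_, fun g x y hxy => ?_⟩
    · refine continuous_iff_continuousAt.2 fun x => ?_
      refine (continuousAt_const (y := (γ x : G ⧸ MulAction.stabilizer G p))).congr ?_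
      filter_upwards [((C.isOpen_halfBox (γ x • p)).preimage continuous_subtype_val).mem_nhds
        (hγ x)] with y hy
      exact (huniq y (γ x) hy).symm
    · rw [MulAction.Quotient.smul_coe]
      apply huniq
      rw [hxy, smul_eq_mul, mul_smul]
      exact smul_mem_halfBox hG g (hγ x)
  -- An orbit without points of `S` has an empty box, and any member of the family will do.
  · obtain ⟨x₀⟩ := ‹Nonempty T›
    have hem : ∀ x : C.orbitBox G S q, False := fun x => by
      obtain ⟨p, hp, hpq, -⟩ := mem_orbitBox.1 x.2
      exact hq ⟨p, hp, hpq⟩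
    exact ⟨_, hF x₀, fun _ => ((1 : G) : G ⧸ _), continuous_const, fun _ x => (hem x).elim⟩

end action

/-- The function that is equal to one near the midpoints of edges and vanishes near vertices. -/
noncomputable def edgeBump (x : T) : ℝ := ∑ᶠ e, bump (C.coord e x)

end TreeCoordinates

/-! ### The invariant partition of unity on a tree -/

namespace EdgeMaps

variable {T E : Type*} [TopologicalSpace T] {V : Set T} {M : EdgeMaps T V E} [ContractibleSpace T]

lemma mem_openEdge_of_coord {e : E} {x : T} (h : M.treeCoordinates.coord e x ∈ Ioo (0 : ℝ) 1) :
    x ∈ M.openEdge e := ⟨_, h, M.treeCoordinates.edge_coord e x h⟩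

lemma coord_of_mem_vertices {x : T} (hx : x ∈ V) (e : E) :
    M.treeCoordinates.coord e x = 0 ∨ M.treeCoordinates.coord e x = 1 := by
  rw [← clamp_of_mem (M.treeCoordinates.coord_mem e x)]
  refine clamp_eq_of_notMem_Ioo fun h => ?_
  obtain ⟨s, hs, rfl⟩ := mem_openEdge_of_coord h
  exact M.edge_notMem e s hs hx

lemma edgeBump_edge (e : E) (s : ℝ) : M.treeCoordinates.edgeBump (M.edge e s) = bump (clamp s) := by
  unfold TreeCoordinates.edgeBump
  rw [finsum_eq_single _ e]
  · exact congrArg bump (M.treeCoordinates.coord_edge_self e s)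
  · intro f hf
    refine bump_of_notMem_Ioo fun h => hf ?_
    exact (M.edge_mem_openEdge_iff.1 (mem_openEdge_of_coord h)).1.symm

lemma edgeBump_of_mem_vertices {x : T} (hx : x ∈ V) : M.treeCoordinates.edgeBump x = 0 := by
  refine finsum_eq_zero_of_forall_eq_zero fun e => bump_of_notMem_Ioo fun h => ?_
  obtain ⟨s, hs, rfl⟩ := mem_openEdge_of_coord h
  exact M.edge_notMem e s hs hx

lemma edgeBump_mem (x : T) : M.treeCoordinates.edgeBump x ∈ Icc (0 : ℝ) 1 := by
  by_cases hx : x ∈ V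
  · rw [edgeBump_of_mem_vertices hx]; simp
  · obtain ⟨e, s, -, rfl⟩ := M.exists_edge x hx
    rw [edgeBump_edge]
    exact clamp_mem _

lemma continuous_edgeBump : Continuous M.treeCoordinates.edgeBump :=
  (M.treeCoordinates.continuous_iff _).2 fun e =>
    (continuous_bump.comp continuous_clamp).congr fun s => (edgeBump_edge e s).symm

lemma edgeBump_smul {G : Type*} [Group G] [MulAction G T] [MulAction G E]
    (hG : M.treeCoordinates.IsEquivariant G) (g : G) (x : T) :
    M.treeCoordinates.edgeBump (g • x) = M.treeCoordinates.edgeBump x := by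
  unfold TreeCoordinates.edgeBump
  rw [← finsum_comp_equiv (MulAction.toPerm g)]
  exact finsum_congr fun e => by
    rw [MulAction.toPerm_apply, TreeCoordinates.coord_smul hG]

/-- The function vanishes near vertices, and every other point has distance less than `1 / 2` from
the midpoint of its edge. -/
lemma tsupport_edgeBump_subset : tsupport M.treeCoordinates.edgeBump ⊆
    ⋃ p ∈ range fun e => M.edge e (1 / 2), M.treeCoordinates.halfBox p := by
  intro x hx
  by_cases hxV : x ∈ V
  · refine absurd hx (notMem_tsupport_iff_eventuallyEq.2 ?_)
    filter_upwards [(M.treeCoordinates.isOpen_box x fun _ => 1 / 6).mem_nhds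
      (M.treeCoordinates.mem_box_self fun _ => by norm_num)] with y hy
    by_cases hyV : y ∈ V
    · exact edgeBump_of_mem_vertices hyV
    · obtain ⟨e, s, hs, rfl⟩ := M.exists_edge y hyV
      have h1 := hy e
      have h2 : M.treeCoordinates.coord e (M.edge e s) = clamp s :=
        M.treeCoordinates.coord_edge_self e s
      rw [h2, abs_lt] at h1
      rw [edgeBump_edge]
      refine bump_eq_zero ?_
      rcases coord_of_mem_vertices (M := M) hxV e with h | h <;> rw [h] at h1
      · left; linarith
      · right; linarith
  · obtain ⟨e, s, hs, rfl⟩ := M.exists_edge x hxV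
    refine mem_iUnion₂.2 ⟨_, ⟨e, rfl⟩, M.treeCoordinates.edge_mem_halfBox ?_⟩
    rw [clamp_of_mem (Ioo_subset_Icc_self hs), clamp_of_mem (by norm_num), abs_lt]
    constructor <;> linarith [hs.1, hs.2]

/-- The function vanishes near midpoints, and every other point of an open edge has distance less
than `1 / 2` from one of its ends. -/
lemma tsupport_one_sub_edgeBump_subset : (tsupport fun x => 1 - M.treeCoordinates.edgeBump x) ⊆
    ⋃ p ∈ V, M.treeCoordinates.halfBox p := by
  intro x hx
  by_cases hxV : x ∈ V
  · exact mem_iUnion₂.2 ⟨x, hxV, M.treeCoordinates.mem_halfBox_self x⟩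
  · obtain ⟨e, s, hs, rfl⟩ := M.exists_edge x hxV
    have hcs := clamp_of_mem (Ioo_subset_Icc_self hs)
    rcases lt_trichotomy s (1 / 2) with h | h | h
    · refine mem_iUnion₂.2 ⟨_, M.edge_zero_mem e, M.treeCoordinates.edge_mem_halfBox ?_⟩
      rw [hcs, clamp_of_mem (by simp), abs_lt]
      constructor <;> linarith [hs.1]
    · subst h
      refine absurd hx (notMem_tsupport_iff_eventuallyEq.2 ?_)
      filter_upwards [(M.treeCoordinates.isOpen_box (M.edge e (1 / 2)) fun _ => 1 / 6).mem_nhds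
        (M.treeCoordinates.mem_box_self fun _ => by norm_num)] with y hy
      have h1 := hy e
      have h2 : M.treeCoordinates.coord e (M.edge e (1 / 2)) = clamp (1 / 2) :=
        M.treeCoordinates.coord_edge_self e _
      rw [h2, hcs] at h1
      have h3 := abs_lt.1 h1
      obtain ⟨s, hs, rfl⟩ := mem_openEdge_of_coord (M := M) (e := e) (x := y)
        ⟨by linarith [h3.1], by linarith [h3.2]⟩
      have h4 : M.treeCoordinates.coord e (M.edge e s) = clamp s :=
        M.treeCoordinates.coord_edge_self e _
      rw [h4] at h1
      rw [edgeBump_edge, bump_eq_one h1.le, sub_self]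
      rfl
    · refine mem_iUnion₂.2 ⟨_, M.edge_one_mem e, M.treeCoordinates.edge_mem_halfBox ?_⟩
      rw [hcs, clamp_of_mem (by simp), abs_lt]
      constructor <;> linarith [hs.2]

/-- Distinct vertices differ by a full unit in some coordinate. -/
lemma eq_of_mem_halfBox_vertices {p q x : T} (hp : p ∈ V) (hq : q ∈ V)
    (hxp : x ∈ M.treeCoordinates.halfBox p) (hxq : x ∈ M.treeCoordinates.halfBox q) : p = q := by
  by_contra hne
  obtain ⟨e, -, he⟩ := M.treeCoordinates.exists_coord_ne hne
  have h1 := abs_lt.1 (hxp e)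
  have h2 := abs_lt.1 (hxq e)
  rcases coord_of_mem_vertices (M := M) hp e with h3 | h3 <;>
    rcases coord_of_mem_vertices (M := M) hq e with h4 | h4 <;> rw [h3, h4] at he <;>
    rw [h3] at h1 <;> rw [h4] at h2
  · exact he rfl
  · linarith [h1.2, h2.1]
  · linarith [h2.2, h1.1]
  · exact he rfl

lemma mem_openEdge_of_mem_halfBox {e : E} {x : T}
    (hx : x ∈ M.treeCoordinates.halfBox (M.edge e (1 / 2))) : x ∈ M.openEdge e := by
  have h1 := hx e
  have h2 : M.treeCoordinates.coord e (M.edge e (1 / 2)) = clamp (1 / 2) :=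
    M.treeCoordinates.coord_edge_self e _
  rw [h2, clamp_of_mem (by norm_num), abs_lt] at h1
  exact mem_openEdge_of_coord ⟨by linarith [h1.1], by linarith [h1.2]⟩

/-- The bump splits over the disjoint boxes around orbits of midpoints, its complement over those
around orbits of vertices. -/
theorem isNumerable {G : Type u} {T : Type v} {E : Type*} [TopologicalSpace T] {V : Set T}
    {M : EdgeMaps T V E} [ContractibleSpace T] [Group G] [TopologicalSpace G] [MulAction G T]
    [MulAction G E] (hV : ∀ (g : G), ∀ x ∈ V, g • x ∈ V)
    (hM : ∀ (g : G) e s, g • M.edge e s = M.edge (g • e) s) (F : SubgroupFamily G)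
    (hF : ∀ x : T, MulAction.stabilizer G x ∈ F.carrier) : IsNumerable F T := by
  set C := M.treeCoordinates with hC
  have hG : C.IsEquivariant G := hM
  set S : Set T := range fun e => M.edge e (1 / 2) with hS
  have hdV : ∀ p ∈ V, ∀ q ∈ V, ∀ x, x ∈ C.halfBox p → x ∈ C.halfBox q → p = q :=
    fun p hp q hq x hxp hxq => eq_of_mem_halfBox_vertices hp hq hxp hxq
  have hdS : ∀ p ∈ S, ∀ q ∈ S, ∀ x, x ∈ C.halfBox p → x ∈ C.halfBox q → p = q := by
    rintro _ ⟨e, rfl⟩ _ ⟨f, rfl⟩ x hxp hxq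
    rw [M.eq_of_mem_openEdge (mem_openEdge_of_mem_halfBox hxp) (mem_openEdge_of_mem_halfBox hxq)]
  have hSG : ∀ (g : G), ∀ p ∈ S, g • p ∈ S := by
    rintro g _ ⟨e, rfl⟩
    exact ⟨g • e, (hM g e _).symm⟩
  -- Both families are indexed by all orbits in `T`, at the price of some empty sets; this keeps the
  -- index type in the universe of `T`.
  let Q := MulAction.orbitRel.Quotient G T
  have hoV := fun q : Q => C.isOpen_orbitBox V q
  have hoS := fun q : Q => C.isOpen_orbitBox S q
  have hpV := TreeCoordinates.disjoint_orbitBox (G := G) hdV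
  have hpS := TreeCoordinates.disjoint_orbitBox (G := G) hdS
  set ρ : T → ℝ := C.edgeBump with hρ
  set σ : T → ℝ := fun x => 1 - C.edgeBump x with hσ
  have hρs : tsupport ρ ⊆ ⋃ q : Q, C.orbitBox G S q := by
    rw [TreeCoordinates.iUnion_orbitBox]
    exact tsupport_edgeBump_subset
  have hσs : tsupport σ ⊆ ⋃ q : Q, C.orbitBox G V q := by
    rw [TreeCoordinates.iUnion_orbitBox]
    exact tsupport_one_sub_edgeBump_subset
  have hρc : Continuous ρ := continuous_edgeBump
  have hσc : Continuous σ := continuous_const.sub continuous_edgeBump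
  have hσG : ∀ (g : G) x, σ (g • x) = σ x := fun g x => by
    simp only [hσ, hC, edgeBump_smul hG g x]
  have hρG : ∀ (g : G) x, ρ (g • x) = ρ x := fun g x => edgeBump_smul hG g x
  have hiff : ∀ {S : Set T} (_ : ∀ (g : G), ∀ p ∈ S, g • p ∈ S) (g : G) (q : Q) (x : T),
      g • x ∈ C.orbitBox G S q ↔ x ∈ C.orbitBox G S q := fun hS g q x =>
    ⟨fun h => by simpa using TreeCoordinates.smul_mem_orbitBox hG hS g⁻¹ q h,
      fun h => TreeCoordinates.smul_mem_orbitBox hG hS g q h⟩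
  have hind : ∀ {S : Set T} (_ : ∀ (g : G), ∀ p ∈ S, g • p ∈ S) (g : G) (q : Q) (x : T)
      {τ : T → ℝ} (_ : ∀ (g : G) x, τ (g • x) = τ x),
      (C.orbitBox G S q).indicator τ (g • x) = (C.orbitBox G S q).indicator τ x := by
    intro S hS g q x τ hτ
    by_cases hx : x ∈ C.orbitBox G S q
    · rw [indicator_of_mem hx, indicator_of_mem ((hiff hS g q x).2 hx), hτ]
    · rw [indicator_of_notMem hx, indicator_of_notMem fun h => hx ((hiff hS g q x).1 h)]
  have hlV := locallyFinite_indicator hoV hpV hσs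
  have hlS := locallyFinite_indicator hoS hpS hρs
  have hsum : ∀ x, ∑ᶠ i : Q ⊕ Q, Sum.elim (fun q => (C.orbitBox G V q).indicator σ x)
      (fun q => (C.orbitBox G S q).indicator ρ x) i = 1 := fun x => by
    rw [finsum_sumElim (hlV.point_finite x) (hlS.point_finite x), finsum_indicator hpV hσs,
      finsum_indicator hpS hρs]
    simp [hσ, hρ]
  let e : PartitionOfUnity (Q ⊕ Q) T :=
    { toFun := Sum.elim
        (fun q => ⟨_, continuous_indicator_of_disjoint hoV hpV hσs hσc q⟩)
        (fun q => ⟨_, continuous_indicator_of_disjoint hoS hpS hρs hρc q⟩)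
      locallyFinite' := by
        intro x
        obtain ⟨A, hA, hA'⟩ := hlV x
        obtain ⟨B, hB, hB'⟩ := hlS x
        refine ⟨A ∩ B, inter_mem hA hB, ((hA'.image Sum.inl).union (hB'.image Sum.inr)).subset ?_⟩
        rintro (q | q) ⟨y, hy, hyA, hyB⟩
        · exact Or.inl ⟨q, ⟨y, hy, hyA⟩, rfl⟩
        · exact Or.inr ⟨q, ⟨y, hy, hyB⟩, rfl⟩
      nonneg' := by
        rintro (q | q) x
        · exact indicator_nonneg (fun y _ => sub_nonneg.2 (edgeBump_mem y).2) x
        · exact indicator_nonneg (fun y _ => (edgeBump_mem y).1) x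
      sum_eq_one' := fun x _ => by
        rw [← hsum x]
        refine finsum_congr ?_
        rintro (q | q) <;> rfl
      sum_le_one' := fun x => by
        rw [← hsum x]
        refine (finsum_congr ?_).le
        rintro (q | q) <;> rfl }
  have : Nonempty T := inferInstance
  refine ⟨Q ⊕ Q, Sum.elim (C.orbitBox G V) (C.orbitBox G S), e, ?_, ?_, ?_, ?_, ?_, ?_⟩
  · rintro (q | q)
    · exact hoV q
    · exact hoS q
  · rintro (q | q) g x hx
    · exact (hiff hV g q x).2 hx
    · exact (hiff hSG g q x).2 hx
  · refine eq_univ_of_forall fun x => ?_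
    rw [iUnion_sum]
    by_cases hx : ρ x = 0
    · exact Or.inl (hσs (subset_tsupport σ (by simp [hσ, ← hρ, hx])))
    · exact Or.inr (hρs (subset_tsupport ρ hx))
  · rintro (q | q)
    · exact TreeCoordinates.exists_orbitBox_map hG F hF hdV hV q
    · exact TreeCoordinates.exists_orbitBox_map hG F hF hdS hSG q
  · rintro (q | q)
    · exact tsupport_indicator_subset hoV hpV hσs q
    · exact tsupport_indicator_subset hoS hpS hρs q
  · rintro (q | q) g x
    · exact hind hV g q x hσG
    · exact hind hSG g q x hρG

end EdgeMaps

end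

theorem mainTheorem8
    (G : Type u) [Group G] [TopologicalSpace G] [IsTopologicalGroup G]
    [LocallyCompactSpace G] [T2Space G]
    (T : Type v) [TopologicalSpace T] [T2Space T] [Topology.CWComplex (Set.univ : Set T)]
    (hT : IsCWTree T)
    [MulAction G T] [ContinuousSMul G T]
    -- the action is cellular, i.e. it preserves the set of vertices
    (hvert : ∀ (g : G), ∀ x ∈ (Topology.RelCWComplex.skeleton (Set.univ : Set T) 0 : Set T),
      g • x ∈ (Topology.RelCWComplex.skeleton (Set.univ : Set T) 0 : Set T))
    -- an element that maps an open cell to a set meeting it fixes the open cell pointwise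
    (hcell : ∀ (g : G) (n : ℕ) (e : Topology.RelCWComplex.cell (Set.univ : Set T) n),
      (((fun x : T => g • x) '' Topology.RelCWComplex.openCell n e) ∩
        Topology.RelCWComplex.openCell n e).Nonempty →
      ∀ x ∈ Topology.RelCWComplex.openCell n e, g • x = x)
    (hiso : ∀ x : T, IsCompact (MulAction.stabilizer G x : Set G)) :
    (∃ (K : Subgroup G) (_ : K.Normal),
      IsCompact (K : Set G) ∧
      Subgroup.connectedComponentOfOne G ≤ K ∧
      TotallyDisconnectedSpace (G ⧸ K) ∧
      ∀ k ∈ K, ∀ x : T, k • x = x) ∧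
    (∃ S : GCWStructure G T,
      (∀ n : ℕ, S.skel n = (Topology.RelCWComplex.skeleton (Set.univ : Set T) n : Set T)) ∧
      S.skel 1 = Set.univ ∧
      GCWStructure.IsModelE.{u, v, w} S (compactSubgroups G) ∧
      GCWStructure.IsModelE.{u, v, w} S (compactOpenSubgroups G)) ∧
    IsModelJ.{u, v, w} (compactSubgroups G) T ∧
    IsModelJ.{u, v, w} (compactOpenSubgroups G) T := by
  have := hT.contractible
  have hne : Nonempty T := inferInstance
  obtain ⟨M₀, hM₀⟩ := hT.exists_edgeMaps
  let : MulAction G (Topology.RelCWComplex.cell (Set.univ : Set T) 1) := M₀.edgeAction hvert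
  have hcomp : M₀.IsCompatible G := M₀.isCompatible_edgeAction hvert
  -- If `g` stabilizes an edge, the translate of the open edge meets it, so the hypothesis on cells
  -- excludes inversions.
  obtain ⟨M, hM⟩ := EdgeMaps.exists_equivariant hcomp hvert fun g e hge x hx => by
    refine hcell g 1 e ⟨g • x, ⟨x, hM₀ e ▸ hx, rfl⟩, hM₀ e ▸ ?_⟩ x (hM₀ e ▸ hx)
    have := hcomp g e x hx
    rwa [hge] at this
  have hopen : ∀ x : T, IsOpen (MulAction.stabilizer G x : Set G) :=
    EdgeMaps.isOpen_stabilizer hM hvert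
  have hG : M.treeCoordinates.IsEquivariant G := hM
  have hskel : ∀ n : ℕ, (Topology.RelCWComplex.skeleton (Set.univ : Set T) (n + 1 : ℕ) : Set T) = Set.univ := fun n => by
    refine Set.eq_univ_of_forall fun x => Topology.CWComplex.mem_skeleton_iff.2 ?_
    have hx : x ∈ ⋃ (n : ℕ) (j : Topology.RelCWComplex.cell (Set.univ : Set T) n), Topology.RelCWComplex.openCell n j := by
      rw [Topology.CWComplex.iUnion_openCell_eq_complex]; trivial
    simp only [Set.mem_iUnion] at hx
    obtain ⟨m, e, he⟩ := hx
    refine ⟨m, ?_, e, he⟩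
    have : m < 2 := by
      by_contra! h
      exact (hT.isEmpty_cell m h).false e
    exact_mod_cast (by omega : m ≤ n + 1)
  obtain ⟨S, hS⟩ := EdgeMaps.exists_gcwStructure hM hvert
    (skel := fun n : ℕ => (Topology.RelCWComplex.skeleton (Set.univ : Set T) n : Set T)) (by simp) hskel
  -- Of the family, only two things matter: it contains all stabilizers and its members are compact.
  -- So both families are treated at once.
  have hJ : ∀ F : SubgroupFamily G, (∀ x : T, MulAction.stabilizer G x ∈ F.carrier) →
      (∀ H ∈ F.carrier, IsCompact (H : Set G)) → IsModelJ.{u, v, w} F T := fun F hF hFc =>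
    ⟨EdgeMaps.isNumerable hvert hM F hF, fun Y _ _ _ _ hY =>
      ⟨TreeCoordinates.exists_isGMap_of_isNumerable hG F hFc hY, fun _ _ h₀ h₁ =>
        TreeCoordinates.gHomotopic hG h₀ h₁⟩⟩
  have hE : ∀ F : SubgroupFamily G, (∀ x : T, MulAction.stabilizer G x ∈ F.carrier) →
      (∀ H ∈ F.carrier, IsCompact (H : Set G)) → GCWStructure.IsModelE.{u, v, w} S F :=
    fun F hF hFc => ⟨hF, fun Y _ _ _ _ ⟨SY⟩ hY =>
      ⟨TreeCoordinates.exists_isGMap_of_gcwStructure hG (fun y => hFc _ (hY y)) SY,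
        fun _ _ h₀ h₁ => TreeCoordinates.gHomotopic hG h₀ h₁⟩⟩
  have hco : ∀ x : T, MulAction.stabilizer G x ∈ (compactOpenSubgroups G).carrier := fun x =>
    ⟨hiso x, hopen x⟩
  refine ⟨exists_compact_normal_subgroup hiso hopen, ⟨S, fun n => by rw [hS], ?_,
    hE (compactSubgroups G) hiso fun _ h => h, hE (compactOpenSubgroups G) hco fun _ h => h.1⟩,
    hJ (compactSubgroups G) hiso fun _ h => h, hJ (compactOpenSubgroups G) hco fun _ h => h.1⟩
  rw [hS]
  exact hskel 0
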